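/- **Existence of $\epsilon$-PNE.** Let $n\ge 1$, $N=\{1,\dots,n\}$. For $i\in N$ let $\mathcal X_i\subset\mathbb R^d$ be a nonempty compact set (not necessarily convex) of diameter at most $\Delta>0$, let $\tilde{\mathcal X}_i=\mathrm{conv}(\mathcal X_i)$, and let $A_i$ be a real $q\times d$ matrix with spectral norm $\|A_i\|_2\le M$, $M>0$. Put $\mathcal X=\prod_i\mathcal X_i$, $\tilde{\mathcal X}=\prod_i\tilde{\mathcal X}_i$, and let $\Omega\subset\mathbb R^q$ be a neighborhood of $\{\frac1n\sum_{j}A_jy_j : y\in\tilde{\mathcal X}\}$. For $i\in N$ let $\theta_i:\mathcal X_i\times\Omega\to\mathbb R$ be such that 1. for every $y\in\Omega$, $x_i\mapsto\theta_i(x_i,y)$ is lower semicontinuous on $\mathcal X_i$; 2. with constants $H>0$, $\gamma>0$ independent of $i$, $|\theta_i(x_i,y')-\theta_i(x_i,y)|\le H\|y'-y\|^\gamma$ for all $x_i\in\mathcal X_i$ and $y,y'\in\Omega$. In the game $\Gamma$, player $i$ chooses $x_i\in\mathcal X_i$ and has cost $f_i(x_i,x_{-i})=\theta_i\big(x_i,\frac1n\sum_{j\in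 N}A_jx_j\big)$, which is defined for $x_i\in\mathcal X_i$ and $x_{-i}\in\prod_{j\ne i}\tilde{\mathcal X}_j$. In the convexified game $\tilde\Gamma$, player $i$ chooses $x_i\in\tilde{\mathcal X}_i$ and has cost $$\tilde f_i(x_i,x_{-i})=\inf\Big\{\sum_{k=1}^{d+1}\alpha^kf_i(z^k,x_{-i}) : \alpha^k\ge 0,\ \sum_{k=1}^{d+1}\alpha^k=1,\ z^k\in\mathcal X_i,\ x_i=\sum_{k=1}^{d+1}\alpha^kz^k\Big\}.$$ A profile $x$ of actions is an $\epsilon$-PNE if no player can lower her cost by more than $\epsilon$ by a unilateral change of action; it is a PNE if it is a $0$-PNE. A *generator* $Z(i,x)$ for $(i,x)$, $x\in\tilde{\mathcal X}$, is the set of the points $z^k$ with $\alpha^k>0$ of some $(\alpha,z)$ at which this infimum is attained. Let $\epsilon=2H\Big(\dfrac{(\sqrt q+1)M\Delta}{n}\Big)^{\gamma}$. Then $\Gamma$ admits an $\epsilon$-PNE. In particular, $\tilde\Gamma$ admits a PNE, and for every PNE $\tilde x\in\tilde{\mathcal X}$ of $\tilde\Gamma$ there is a generator for $(i,\tilde x)$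 for each $i\in N$. For any choice whatsoever of generators $Z(i,\tilde x)$, $i\in N$, the set $$\underset{x_i\in Z(i,\tilde x),\ i\in N}{\operatorname{argmin}}\ \Big\|\sum_{i\in N}A_i\tilde x_i-\sum_{i\in N}A_ix_i\Big\|^2$$ is nonempty, and each of its elements $x^*$ is an $\epsilon$-PNE of $\Gamma$. -/

import Mathlib

open scoped Topology Matrix.Norms.L2Operator

noncomputable section

/-- An `n`-player cost-minimisation game whose players choose points of `ℝ^d`.
`cost i x` is the cost of player `i` at the profile `x`, i.e. `f_i(x_i, x_{-i})`; a unilateral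
change of the action of `i` to `z` is the profile `Function.update x i z`. Only the values of
`cost i` at profiles where a game is really evaluated matter. -/
structure Game (n d : ℕ) where
  action : Fin n → Set (EuclideanSpace ℝ (Fin d))
  cost : Fin n → (Fin n → EuclideanSpace ℝ (Fin d)) → ℝ

namespace Game

variable {n d : ℕ}

/-- Additive `ε`-pure Nash equilibrium. -/
def IsEpsPNE (G : Game n d) (ε : ℝ) (x : Fin n → EuclideanSpace ℝ (Fin d)) : Prop :=
  (∀ i, x i ∈ G.action i) ∧
    ∀ i, ∀ z ∈ G.action i, G.cost i x ≤ G.cost i (Function.update x i z) + ε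

/-- Pure Nash equilibrium. -/
def IsPNE (G : Game n d) (x : Fin n → EuclideanSpace ℝ (Fin d)) : Prop :=
  G.IsEpsPNE 0 x

/-- `(α, z)` is a feasible point of the minimisation problem defining the convexified cost of
player `i` at `x`: `α` lies in the `d`-dimensional probability simplex, the `d + 1` points `z k`
are actions of `i`, and `x i` is their convex combination with coefficients `α`. -/
def IsDecomposition (G : Game n d) (i : Fin n) (x : Fin n → EuclideanSpace ℝ (Fin d))
    (α : Fin (d + 1) → ℝ) (z : Fin (d + 1) → EuclideanSpace ℝ (Fin d)) : Prop :=
  α ∈ stdSimplex ℝ (Fin (d + 1)) ∧ (∀ k, z k ∈ G.action i) ∧ x i = ∑ k, α k • z k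

/-- The objective `∑ k, α^k f_i(z^k, x_{-i})` of that problem. -/
def decompositionCost (G : Game n d) (i : Fin n) (x : Fin n → EuclideanSpace ℝ (Fin d))
    (α : Fin (d + 1) → ℝ) (z : Fin (d + 1) → EuclideanSpace ℝ (Fin d)) : ℝ :=
  ∑ k, α k * G.cost i (Function.update x i (z k))

/-- The convexified game. -/
def convexified (G : Game n d) : Game n d where
  action i := convexHull ℝ (G.action i)
  cost i x := sInf {c | ∃ α z, G.IsDecomposition i x α z ∧ c = G.decompositionCost i x α z}

/-- `Z` is a generator for `(i, x)`: the minimum defining the convexified cost is attained at some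
`(α, z)`, and `Z` consists of the points `z k` that carry a positive coefficient. (A point with
coefficient zero does not take part in the decomposition of `x i` and could be any action.) -/
def IsGenerator (G : Game n d) (i : Fin n) (x : Fin n → EuclideanSpace ℝ (Fin d))
    (Z : Set (EuclideanSpace ℝ (Fin d))) : Prop :=
  ∃ α z, G.IsDecomposition i x α z ∧
    (∀ β w, G.IsDecomposition i x β w →
      G.decompositionCost i x α z ≤ G.decompositionCost i x β w) ∧
    Z = {p | ∃ k, 0 < α k ∧ p = z k}

end Game

/-- The aggregate `∑ j, A_j x_j` of a profile. -/
def aggregate {n d q : ℕ} (A : Fin n → Matrix (Fin q) (Fin d) ℝ)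
    (x : Fin n → EuclideanSpace ℝ (Fin d)) : EuclideanSpace ℝ (Fin q) :=
  ∑ j, Matrix.toEuclideanLin (A j) (x j)

/-- The (weighted) sum-aggregative game with action sets `X i` and costs
`f_i(x) = θ_i(x_i, (1/n) ∑ j, A_j x_j)`. -/
def sumAggregativeGame {n d q : ℕ} (X : Fin n → Set (EuclideanSpace ℝ (Fin d)))
    (A : Fin n → Matrix (Fin q) (Fin d) ℝ)
    (θ : Fin n → EuclideanSpace ℝ (Fin d) → EuclideanSpace ℝ (Fin q) → ℝ) : Game n d where
  action := X
  cost i x := θ i (x i) ((1 / (n : ℝ)) • aggregate A x)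

/-- `x` belongs to the argmin, over the profiles with `x_i ∈ Z i` for all `i`, of
`‖∑ i, A_i y_i - ∑ i, A_i x_i‖ ^ 2`. -/
def IsDisaggregation {n d q : ℕ} (A : Fin n → Matrix (Fin q) (Fin d) ℝ)
    (y : Fin n → EuclideanSpace ℝ (Fin d)) (Z : Fin n → Set (EuclideanSpace ℝ (Fin d)))
    (x : Fin n → EuclideanSpace ℝ (Fin d)) : Prop :=
  (∀ i, x i ∈ Z i) ∧ ∀ w : Fin n → EuclideanSpace ℝ (Fin d), (∀ i, w i ∈ Z i) →
    ‖aggregate A y - aggregate A x‖ ^ 2 ≤ ‖aggregate A y - aggregate A w‖ ^ 2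

end

/-! At a PNE `y` of the convexified game, the cost of player `i` is a weighted average of the values
`f_i(z, y_{-i})` over her generator. No action in `X i` does better than this average, since a pure
action is a trivial decomposition. Hence every generator point is a best reply to `y_{-i}`
(`Game.IsGenerator.cost_le`). The Shapley–Folkman–Starr theorem (`exists_selection_norm_le`) selects
generator points whose aggregate is within `√q * (M * Δ)` of that of `y`, however large `n` is, and
a minimiser `x` of the distance is at least as close. If player `i` plays the same action against
`x` and against `y`, the aggregates differ by at most `(√q + 1) * M * Δ`. After division by `n`, the
Hölder condition bounds the change of cost by `ε / 2`. This is used twice, at `x i` and at the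
deviation.

The equilibrium `y` comes from Ky Fan's inequality applied to the Nikaido–Isoda function. This needs
the convexified cost to be convex in the own action, jointly lower semicontinuous, and upper
semicontinuous in the profile once the own action is fixed. Convexity rests on a Carathéodory
reduction that does not increase cost. Ky Fan's inequality follows from Brouwer's theorem on a
simplex, which is proved here by applying Scarf's lemma to finer and finer grids. -/

/-- A finite set `σ` is dominant for a family of orders, given by rank functions `p i`, if no point
is strictly above all of `σ` in each of the orders at once. -/
def IsDominant {T I β : Type*} [LE β] (p : I → T → β) (σ : Finset T) : Prop :=
  ∀ y, ∃ i, ∀ x ∈ σ, p i y ≤ p i x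

/-! ### Dominant sets and Scarf's lemma. -/

section Scarf

variable {T I β : Type*} [LinearOrder β] {p : I → T → β}

lemma IsDominant.mono {σ τ : Finset T} (h : IsDominant p σ) (hτ : τ ⊆ σ) : IsDominant p τ :=
  fun y => (h y).imp fun _ hi x hx => hi x (hτ hx)

open Classical in
/-- The points by which `τ` can be enlarged to a dominant set. -/
noncomputable def dominantExtensions [Fintype T] [DecidableEq T] (p : I → T → β) (τ : Finset T) :
    Finset T :=
  {y | y ∉ τ ∧ IsDominant p (insert y τ)}

lemma mem_dominantExtensions [Fintype T] [DecidableEq T] {τ : Finset T} {y : T} :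
    y ∈ dominantExtensions p τ ↔ y ∉ τ ∧ IsDominant p (insert y τ) := by
  simp [dominantExtensions]

/-- A point above the minima of `τ` in all orders but `a` can be blocked only in order `a`, where
`y` is highest among such points. Any other point is blocked in some order `k ≠ a`, where `y` does
not lower the minimum. -/
lemma insert_dominant_of_maximal [DecidableEq T] {τ : Finset T} (hτ : IsDominant p τ) {m : I → T}
    (hm : ∀ i, m i ∈ τ ∧ ∀ x ∈ τ, p i (m i) ≤ p i x) {a : I} {y : T}
    (hy : ∀ k ≠ a, p k (m k) < p k y)
    (hmax : ∀ w, (∀ k ≠ a, p k (m k) < p k w) → p a w ≤ p a y) :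
    IsDominant p (insert y τ) := by
  intro w
  by_cases hw : ∀ k ≠ a, p k (m k) < p k w
  · obtain ⟨i, hi⟩ := hτ w
    have hia : i = a := by
      by_contra h
      exact absurd (hw i h) (not_lt.2 (hi _ (hm i).1))
    subst hia
    refine ⟨i, fun x hx => ?_⟩
    rcases Finset.mem_insert.1 hx with rfl | hx
    · exact hmax w hw
    · exact hi x hx
  · push Not at hw
    obtain ⟨k, hka, hk⟩ := hw
    refine ⟨k, fun x hx => ?_⟩
    rcases Finset.mem_insert.1 hx with rfl | hx
    · exact hk.trans (hy k hka).le
    · exact hk.trans ((hm k).2 x hx)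

lemma maximal_of_insert_dominant [DecidableEq T] {τ : Finset T} {m : I → T}
    (hm : ∀ i, m i ∈ τ ∧ ∀ x ∈ τ, p i (m i) ≤ p i x) {a : I} {y : T}
    (hdom : IsDominant p (insert y τ)) (w : T) (hw : ∀ k ≠ a, p k (m k) < p k w) :
    p a w ≤ p a y := by
  obtain ⟨i, hi⟩ := hdom w
  have hia : i = a := by
    by_contra h
    exact absurd (hw i h) (not_lt.2 (hi _ (Finset.mem_insert_of_mem (hm i).1)))
  subst hia
  exact hi y (Finset.mem_insert_self _ _)

/-- In a dominant `insert y τ`, each old point must stay the minimum in some order. Only the point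
that is minimal in both `a` and `b` can give up an order, so `y` takes over `a` or `b`. In either
case maximality determines `y`. -/
lemma card_dominantExtensions_eq_two [Fintype T] [DecidableEq T]
    (hp : ∀ i, Function.Injective (p i)) {τ : Finset T}
    (hτ : IsDominant p τ) {m : I → T}
    (hm : ∀ i, m i ∈ τ ∧ ∀ x ∈ τ, p i (m i) ≤ p i x) {a b : I} (hab : a ≠ b) (hmab : m a = m b)
    (hinj : ∀ k l, m k = m l → k = l ∨ (k = a ∧ l = b) ∨ (k = b ∧ l = a))
    (hsurj : ∀ x ∈ τ, ∃ k, m k = x)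
    (ha : ∃ w, ∀ k ≠ a, p k (m k) < p k w) (hb : ∃ w, ∀ k ≠ b, p k (m k) < p k w) :
    (dominantExtensions p τ).card = 2 := by
  classical
  have key : ∀ a : I, (∃ w, ∀ k ≠ a, p k (m k) < p k w) →
      ∃ y, (∀ k ≠ a, p k (m k) < p k y) ∧
        ∀ w, (∀ k ≠ a, p k (m k) < p k w) → p a w ≤ p a y := by
    rintro a ⟨w, hw⟩
    obtain ⟨y, hy, hmax⟩ := Finset.exists_max_image
      ({w | ∀ k ≠ a, p k (m k) < p k w} : Finset T) (p a) ⟨w, by simpa using hw⟩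
    simp only [Finset.mem_filter, Finset.mem_univ, true_and] at hy hmax
    exact ⟨y, hy, hmax⟩
  obtain ⟨ya, hya, hamax⟩ := key a ha
  obtain ⟨yb, hyb, hbmax⟩ := key b hb
  have notMem : ∀ {y : T} {a b : I}, a ≠ b → m a = m b → (∀ k ≠ a, p k (m k) < p k y) →
      y ∉ τ := by
    intro y a b hab hmab hy hyτ
    obtain ⟨k, rfl⟩ := hsurj y hyτ
    by_cases hk : k = a
    · subst hk
      have := hy b hab.symm
      rw [hmab] at this
      exact lt_irrefl _ this
    · exact lt_irrefl _ (hy k hk)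
  have hne : ya ≠ yb := by
    rintro rfl
    obtain ⟨i, hi⟩ := hτ ya
    have := hi _ (hm i).1
    by_cases hia : i = a
    · exact absurd (hyb i (hia ▸ hab)) (not_lt.2 this)
    · exact absurd (hya i hia) (not_lt.2 this)
  rw [Finset.card_eq_two]
  refine ⟨ya, yb, hne, ?_⟩
  ext y
  rw [mem_dominantExtensions, Finset.mem_insert, Finset.mem_singleton]
  constructor
  · rintro ⟨hyτ, hdom⟩
    have low : ∀ x ∈ τ, ∃ i, m i = x ∧ p i (m i) < p i y := by
      intro x hx
      obtain ⟨i, hi⟩ := hdom x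
      have hmx : m i = x := hp i (le_antisymm ((hm i).2 x hx)
        (hi _ (Finset.mem_insert_of_mem (hm i).1)))
      refine ⟨i, hmx, lt_of_le_of_ne ?_ fun h => hyτ (hp i h ▸ (hm i).1)⟩
      rw [hmx]
      exact hi y (Finset.mem_insert_self _ _)
    have other : ∀ k, k ≠ a → k ≠ b → p k (m k) < p k y := by
      intro k hka hkb
      obtain ⟨i, hi, hlt⟩ := low (m k) (hm k).1
      rcases hinj i k hi with h | h | h
      · exact h ▸ hlt
      · exact absurd h.2 hkb
      · exact absurd h.2 hka
    obtain ⟨i, hi, hlt⟩ := low (m a) (hm a).1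
    have hi' : i = a ∨ i = b := by
      rcases hinj i a hi with h | h | h
      · exact Or.inl h
      · exact Or.inl h.1
      · exact Or.inr h.1
    rcases hi' with rfl | rfl
    · right
      have hy : ∀ k ≠ b, p k (m k) < p k y := fun k hk => by
        by_cases h : k = i
        · exact h ▸ hlt
        · exact other k h hk
      exact hp b (le_antisymm (hbmax y hy) (maximal_of_insert_dominant hm hdom yb hyb))
    · left
      have hy : ∀ k ≠ a, p k (m k) < p k y := fun k hk => by
        by_cases h : k = i
        · exact h ▸ hlt
        · exact other k hk h
      exact hp a (le_antisymm (hamax y hy) (maximal_of_insert_dominant hm hdom ya hya))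
  · rintro (rfl | rfl)
    · exact ⟨notMem hab hmab hya, insert_dominant_of_maximal hτ hm hya hamax⟩
    · exact ⟨notMem hab.symm hmab.symm hyb, insert_dominant_of_maximal hτ hm hyb hbmax⟩

/-- A surjection between finite sets whose sizes differ by one identifies exactly one pair. -/
lemma exists_unique_collision [DecidableEq T] [Fintype I] [DecidableEq I] {m : I → T}
    {τ : Finset T} (hm : ∀ i, m i ∈ τ)
    (hsurj : ∀ x ∈ τ, ∃ k, m k = x) (hcard : τ.card + 1 = Fintype.card I) :
    ∃ a b, a ≠ b ∧ m a = m b ∧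
      ∀ k l, m k = m l → k = l ∨ (k = a ∧ l = b) ∨ (k = b ∧ l = a) := by
  obtain ⟨a, -, b, -, hab, hmab⟩ := Finset.exists_ne_map_eq_of_card_lt_of_maps_to
    (s := Finset.univ) (t := τ) (f := m) (by rw [Finset.card_univ]; omega) (fun i _ => hm i)
  have inj : ∀ {a b : I}, a ≠ b → m a = m b → Set.InjOn m (Finset.univ.erase a : Finset I) := by
    intro a b hab hmab
    have : (Finset.univ.erase a).image m = τ := by
      ext x
      simp only [Finset.mem_image, Finset.mem_erase, Finset.mem_univ, and_true]
      refine ⟨fun ⟨k, _, hk⟩ => hk ▸ hm k, fun hx => ?_⟩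
      obtain ⟨k, rfl⟩ := hsurj x hx
      by_cases hk : k = a
      · exact ⟨b, hab.symm, by rw [hk, hmab]⟩
      · exact ⟨k, hk, rfl⟩
    rw [← Finset.card_image_iff, this, Finset.card_erase_of_mem (Finset.mem_univ _),
      Finset.card_univ]
    omega
  refine ⟨a, b, hab, hmab, fun k l hkl => ?_⟩
  have h1 := @inj a b hab hmab k
  have h2 := @inj b a hab.symm hmab.symm k
  simp only [Finset.coe_erase, Finset.coe_univ, Set.mem_sdiff, Set.mem_univ, Set.mem_singleton_iff,
    true_and] at h1 h2
  by_cases hkl' : k = l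
  · exact Or.inl hkl'
  have h1' : k = a ∨ l = a := by
    by_contra! h
    exact hkl' (h1 h.1 h.2 hkl)
  have h2' : k = b ∨ l = b := by
    by_contra! h
    exact hkl' (h2 h.1 h.2 hkl)
  grind

/-- Slack points: `s i` is lowest in the `i`-th order, and in this order the other slack points lie
above all ordinary points. -/
structure IsSlack (p : I → T → β) (s : I → T) : Prop where
  bot : ∀ i y, p i (s i) ≤ p i y
  top : ∀ i k y, k ≠ i → y ∉ Set.range s → p i y < p i (s k)

/-- The count is 0 if `τ` is not dominant and 2 otherwise. When `m a = m b`, the slack point `s a`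
is the point above the minima in all orders but `a` that the two-extension count requires. This
fails only for sets made of slack points other than some `s j`, which `hout` excludes. -/
lemma IsSlack.even_card_dominantExtensions [Fintype T] [DecidableEq T] [Fintype I] [DecidableEq I]
    {s : I → T} (hs : IsSlack p s)
    (hp : ∀ i, Function.Injective (p i)) {τ : Finset T} (hcard : τ.card + 1 = Fintype.card I)
    (hout : ∀ j, ¬ τ ⊆ (Finset.univ.erase j).image s) : Even (dominantExtensions p τ).card := by
  by_cases hτ : IsDominant p τ
  swap
  · have : dominantExtensions p τ = ∅ := by
      ext y
      simp only [mem_dominantExtensions, Finset.notMem_empty, iff_false, not_and]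
      exact fun _ h => hτ (h.mono (Finset.subset_insert _ _))
    simp [this]
  have hne : τ.Nonempty := by
    rw [Finset.nonempty_iff_ne_empty]
    rintro rfl
    have : 0 < Fintype.card I := by omega
    obtain ⟨j⟩ := Fintype.card_pos_iff.1 this
    exact hout j (Finset.empty_subset _)
  choose m hm using fun i => Finset.exists_min_image τ (p i) hne
  have hsurj : ∀ x ∈ τ, ∃ k, m k = x := by
    intro x hx
    obtain ⟨i, hi⟩ := hτ x
    exact ⟨i, hp i (le_antisymm ((hm i).2 x hx) (hi _ (hm i).1))⟩
  obtain ⟨a, b, hab, hmab, hinj⟩ := exists_unique_collision (fun i => (hm i).1) hsurj hcard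
  have hlow : ∀ j, m j ∉ Set.range s ∨ m j = s j := by
    intro j
    by_contra! h
    obtain ⟨⟨k, hk⟩, h2⟩ := h
    apply hout j
    intro x hx
    by_contra hx'
    have hle := (hm j).2 x hx
    by_cases hxs : x ∈ Set.range s
    · obtain ⟨l, rfl⟩ := hxs
      have : l = j := by
        by_contra hl
        exact hx' (Finset.mem_image_of_mem _ (by simp [hl]))
      subst this
      exact h2 (hp l (le_antisymm hle (hs.bot l _)))
    · have hkj : k ≠ j := by
        rintro rfl
        exact h2 hk.symm
      exact absurd (hs.top j k x hkj hxs) (not_lt.2 (hk ▸ hle))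
  have key : ∀ {a b : I}, a ≠ b → m a = m b → ∃ w, ∀ k ≠ a, p k (m k) < p k w := by
    intro a b hab hmab
    have hsa : s a ∉ τ := by
      intro hsa
      have h1 : m a = s a := hp a (le_antisymm ((hm a).2 _ hsa) (hs.bot a _))
      rcases hlow b with h | h
      · exact h ⟨a, by rw [← hmab, h1]⟩
      · have hsab : s a = s b := by rw [← h1, hmab, h]
        apply hout a
        intro x hx
        by_contra hx'
        by_cases hxs : x ∈ Set.range s
        · obtain ⟨l, rfl⟩ := hxs
          by_cases hl : l = a
          · subst hl
            exact hx' (Finset.mem_image.2 ⟨b, by simp [hab.symm], hsab.symm⟩)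
          · exact hx' (Finset.mem_image_of_mem _ (by simp [hl]))
        · have := hs.top b a x hab hxs
          rw [hsab] at this
          exact absurd (hs.bot b x) (not_le.2 this)
    refine ⟨s a, fun k hk => ?_⟩
    rcases hlow k with h | h
    · exact hs.top k a _ hk.symm h
    · rw [h]
      refine lt_of_le_of_ne (hs.bot k _) fun h' => hsa ?_
      rw [← hp k h', ← h]
      exact (hm k).1
  rw [card_dominantExtensions_eq_two hp hτ hm hab hmab hinj hsurj (key hab hmab)
    (key hab.symm hmab.symm)]
  exact even_two

/-- In an order `i ≠ j` the facet contains the bottom point `s i`, so a point outside it can be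
blocked only in order `j`. The unique extension is therefore the `j`-highest point outside the
facet. -/
lemma IsSlack.card_dominantExtensions_outer [Fintype T] [DecidableEq T] [Fintype I] [DecidableEq I]
    {s : I → T} (hs : IsSlack p s)
    (hp : ∀ i, Function.Injective (p i)) (hsi : Function.Injective s) (j : I) :
    (dominantExtensions p ((Finset.univ.erase j).image s)).card = 1 := by
  classical
  set τ := (Finset.univ.erase j).image s with hτ
  have hmem : ∀ k, k ≠ j → s k ∈ τ := fun k hk => Finset.mem_image_of_mem _ (by simp [hk])
  have hsj : s j ∉ τ := by
    rw [hτ, Finset.mem_image]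
    rintro ⟨k, hk, h⟩
    exact (Finset.mem_erase.1 hk).1 (hsi h)
  have hlt : ∀ w ∉ τ, ∀ x ∈ τ, p j w ≤ p j x := by
    intro w hw x hx
    obtain ⟨k, hk, rfl⟩ := Finset.mem_image.1 hx
    by_cases hws : w ∈ Set.range s
    · obtain ⟨l, rfl⟩ := hws
      have : l = j := by
        by_contra hl
        exact hw (hmem l hl)
      subst this
      exact hs.bot _ _
    · exact (hs.top j k w (Finset.mem_erase.1 hk).1 hws).le
  obtain ⟨y, hy, hmax⟩ := Finset.exists_max_image τᶜ (p j) ⟨s j, by simpa using hsj⟩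
  simp only [Finset.mem_compl] at hy hmax
  rw [Finset.card_eq_one]
  refine ⟨y, ?_⟩
  ext z
  rw [mem_dominantExtensions, Finset.mem_singleton]
  constructor
  · rintro ⟨hz, hdom⟩
    obtain ⟨i, hi⟩ := hdom y
    by_cases hij : i = j
    · subst hij
      exact hp i (le_antisymm (hmax z hz) (hi z (Finset.mem_insert_self _ _)))
    · have := hi (s i) (Finset.mem_insert_of_mem (hmem i hij))
      exact absurd (hp i (le_antisymm this (hs.bot i y)) ▸ hmem i hij) hy
  · rintro rfl
    refine ⟨hy, fun w => ?_⟩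
    by_cases hw : w ∈ τ
    · obtain ⟨k, -, rfl⟩ := Finset.mem_image.1 hw
      exact ⟨k, fun x _ => hs.bot k x⟩
    · refine ⟨j, fun x hx => ?_⟩
      rcases Finset.mem_insert.1 hx with rfl | hx
      · exact hmax w hw
      · exact hlt w hw x hx

/-- If one such `x` exists, `σ` has exactly the colours other than `i₀`, with one more point than
colours. The removable points are then the two that share a colour. -/
lemma even_card_erase_of_not_surjective [DecidableEq T] [Fintype I] [DecidableEq I] {c : T → I}
    {i₀ : I} {σ : Finset T}
    (hcard : σ.card = Fintype.card I) (hσ : σ.image c ≠ Finset.univ) :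
    Even ({x ∈ σ | (σ.erase x).image c = Finset.univ.erase i₀} : Finset T).card := by
  rcases Finset.eq_empty_or_nonempty
    ({x ∈ σ | (σ.erase x).image c = Finset.univ.erase i₀} : Finset T) with h | ⟨x₀, hx₀⟩
  · simp [h]
  obtain ⟨hx₀, h₀⟩ := Finset.mem_filter.1 hx₀
  have himg : σ.image c = Finset.univ.erase i₀ := by
    apply le_antisymm _ (h₀ ▸ Finset.image_subset_image (Finset.erase_subset _ _))
    intro i hi
    refine Finset.mem_erase.2 ⟨?_, Finset.mem_univ _⟩
    rintro rfl
    apply hσ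
    rw [Finset.eq_univ_iff_forall]
    intro k
    by_cases hk : k = i
    · exact hk ▸ hi
    · exact Finset.image_subset_image (Finset.erase_subset x₀ _)
        (h₀ ▸ Finset.mem_erase.2 ⟨hk, Finset.mem_univ _⟩)
  have hpos : 0 < Fintype.card I := Fintype.card_pos_iff.2 ⟨i₀⟩
  have hE : (Finset.univ.erase i₀).card + 1 = Fintype.card I := by
    rw [Finset.card_erase_of_mem (Finset.mem_univ _), Finset.card_univ]
    omega
  obtain ⟨x, hx, y, hy, hxy, hc⟩ := Finset.exists_ne_map_eq_of_card_lt_of_maps_to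
    (s := σ) (t := Finset.univ.erase i₀) (f := c) (by omega)
    (fun z hz => himg ▸ Finset.mem_image_of_mem c hz)
  have good : ∀ {x y : T}, x ∈ σ → y ∈ σ → x ≠ y → c x = c y →
      (σ.erase x).image c = Finset.univ.erase i₀ := by
    intro x y hx hy hxy hc
    rw [← himg]
    apply le_antisymm (Finset.image_subset_image (Finset.erase_subset _ _))
    intro i hi
    obtain ⟨z, hz, rfl⟩ := Finset.mem_image.1 hi
    by_cases hzx : z = x
    · rw [hzx, hc]
      exact Finset.mem_image_of_mem c (Finset.mem_erase.2 ⟨hxy.symm, hy⟩)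
    · exact Finset.mem_image_of_mem c (Finset.mem_erase.2 ⟨hzx, hz⟩)
  have : ({x ∈ σ | (σ.erase x).image c = Finset.univ.erase i₀} : Finset T) = {x, y} := by
    ext z
    rw [Finset.mem_filter, Finset.mem_insert, Finset.mem_singleton]
    constructor
    · rintro ⟨hz, h⟩
      by_contra! hzxy
      have hinj : Set.InjOn c (σ.erase z : Finset T) := by
        rw [← Finset.card_image_iff, h, Finset.card_erase_of_mem hz]
        omega
      exact hxy (hinj (Finset.mem_coe.2 (Finset.mem_erase.2 ⟨hzxy.1.symm, hx⟩))
        (Finset.mem_coe.2 (Finset.mem_erase.2 ⟨hzxy.2.symm, hy⟩)) hc)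
    · rintro (rfl | rfl)
      · exact ⟨hx, good hx hy hxy hc⟩
      · exact ⟨hy, good hy hx hxy.symm hc.symm⟩
  rw [this, Finset.card_pair hxy]
  exact even_two

/-- **Scarf's lemma**: if the slack point `s i` has colour `i` for all `i`, then some dominant set
carries each colour exactly once. -/
theorem IsSlack.exists_dominant_colourful [Fintype T] [DecidableEq T] [Fintype I] [DecidableEq I]
    {s : I → T} (hs : IsSlack p s)
    (hp : ∀ i, Function.Injective (p i)) [Nonempty I] {c : T → I} (hc : ∀ i, c (s i) = i) :
    ∃ σ : Finset T, σ.card = Fintype.card I ∧ σ.image c = Finset.univ ∧ IsDominant p σ := by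
  classical
  by_contra! hno
  obtain ⟨i₀⟩ := ‹Nonempty I›
  have hsi : Function.Injective s := fun i j h => by rw [← hc i, ← hc j, h]
  set E : Finset I := Finset.univ.erase i₀ with hE
  have hEcard : E.card + 1 = Fintype.card I := by
    have : 0 < Fintype.card I := Fintype.card_pos_iff.2 ⟨i₀⟩
    rw [hE, Finset.card_erase_of_mem (Finset.mem_univ _), Finset.card_univ]
    omega
  -- Double counting: grouping these pairs by `insert q.2 q.1` gives an even total if no colourful
  -- dominant set exists, while grouping by `q.1` gives an odd one.
  let P : Finset (Finset T × T) :=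
    {q | q.1.card + 1 = Fintype.card I ∧ q.1.image c = E ∧ q.2 ∉ q.1 ∧
      IsDominant p (insert q.2 q.1)}
  have hP : ∀ q, q ∈ P ↔ q.1.card + 1 = Fintype.card I ∧ q.1.image c = E ∧ q.2 ∉ q.1 ∧
      IsDominant p (insert q.2 q.1) := fun q => by simp [P]
  have heven : Even P.card := by
    rw [Finset.card_eq_sum_card_fiberwise (f := fun q => insert q.2 q.1) (t := Finset.univ)
      (fun _ _ => Finset.mem_coe.2 (Finset.mem_univ _))]
    refine Finset.even_sum _ fun σ _ => ?_
    by_cases hσ : σ.card = Fintype.card I ∧ IsDominant p σ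
    · have := even_card_erase_of_not_surjective (c := c) (i₀ := i₀) hσ.1
        (fun h => hno σ hσ.1 h hσ.2)
      refine (congrArg Even ?_).mpr this
      refine Finset.card_nbij' (fun q => q.2) (fun x => (σ.erase x, x)) ?_ ?_ ?_ ?_
      · rintro ⟨τ, y⟩ hq
        simp only [Finset.coe_filter, Set.mem_ofPred_eq, hP] at hq ⊢
        obtain ⟨⟨h1, h2, h3, h4⟩, rfl⟩ := hq
        exact ⟨Finset.mem_insert_self _ _, by rw [Finset.erase_insert h3, h2]⟩
      · intro x hx
        simp only [Finset.coe_filter, Set.mem_ofPred_eq, hP] at hx ⊢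
        rw [Finset.insert_erase hx.1, Finset.card_erase_add_one hx.1]
        exact ⟨⟨hσ.1, hx.2, Finset.notMem_erase _ _, hσ.2⟩, rfl⟩
      · rintro ⟨τ, y⟩ hq
        simp only [Finset.coe_filter, Set.mem_ofPred_eq, hP] at hq ⊢
        obtain ⟨⟨h1, h2, h3, h4⟩, rfl⟩ := hq
        rw [Finset.erase_insert h3]
      · intro x hx
        rfl
    · have : ({q ∈ P | insert q.2 q.1 = σ} : Finset _) = ∅ := by
        rw [Finset.filter_eq_empty_iff]
        rintro ⟨τ, y⟩ hq rfl
        rw [hP] at hq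
        exact hσ ⟨by rw [Finset.card_insert_of_notMem hq.2.2.1]; exact hq.1, hq.2.2.2⟩
      simp [this]
  set τ₀ : Finset T := E.image s with hτ₀
  have hτ₀c : τ₀.image c = E := by
    rw [hτ₀, Finset.image_image]
    rw [show c ∘ s = id from funext hc, Finset.image_id]
  have hτ₀card : τ₀.card + 1 = Fintype.card I := by
    rw [hτ₀, Finset.card_image_of_injective _ hsi, hEcard]
  have hfib : ∀ τ : Finset T, τ.card + 1 = Fintype.card I → τ.image c = E →
      ({q ∈ P | q.1 = τ} : Finset _).card = (dominantExtensions p τ).card := by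
    intro τ h1 h2
    refine Finset.card_nbij' (fun q => q.2) (fun x => (τ, x)) ?_ ?_ ?_ ?_
    · rintro ⟨τ, y⟩ hq
      simp only [Finset.coe_filter, Set.mem_ofPred_eq, hP] at hq
      obtain ⟨⟨h1, h2, h3, h4⟩, rfl⟩ := hq
      exact Finset.mem_coe.2 (mem_dominantExtensions.2 ⟨h3, h4⟩)
    · intro x hx
      have := mem_dominantExtensions.1 (Finset.mem_coe.1 hx)
      simp only [Finset.coe_filter, Set.mem_ofPred_eq, hP]
      exact ⟨⟨h1, h2, this⟩, trivial⟩
    · rintro ⟨τ, y⟩ hq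
      simp only [Finset.coe_filter, Set.mem_ofPred_eq, hP] at hq
      simp [hq.2]
    · intro x hx
      rfl
  have hodd : Odd P.card := by
    rw [Finset.card_eq_sum_card_fiberwise (f := fun q => q.1) (t := Finset.univ)
      (fun _ _ => Finset.mem_coe.2 (Finset.mem_univ _)),
      ← Finset.add_sum_erase _ _ (Finset.mem_univ τ₀), hfib τ₀ hτ₀card hτ₀c,
      hs.card_dominantExtensions_outer hp hsi i₀]
    refine Even.one_add (Finset.even_sum _ fun τ hτ => ?_)
    by_cases h : τ.card + 1 = Fintype.card I ∧ τ.image c = E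
    · rw [hfib τ h.1 h.2]
      refine hs.even_card_dominantExtensions hp h.1 fun j hj => (Finset.mem_erase.1 hτ).1 ?_
      -- A set inside the outer facet without `s j` lacks colour `j`. This forces `j = i₀`, and by
      -- cardinality the set is `τ₀`, the only one with an odd contribution.
      have hjE : E ⊆ Finset.univ.erase j := by
        rw [← h.2]
        refine (Finset.image_subset_image hj).trans ?_
        rw [Finset.image_image]
        intro i hi
        obtain ⟨k, hk, rfl⟩ := Finset.mem_image.1 hi
        simpa [hc] using hk
      have hji : j = i₀ := by
        by_contra hji
        exact Finset.notMem_erase j _ (hjE (Finset.mem_erase.2 ⟨hji, Finset.mem_univ _⟩))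
      subst hji
      exact Finset.eq_of_subset_of_card_le hj (by
        rw [Finset.card_image_of_injective _ hsi]
        have := h.1
        omega)
    · have : ({q ∈ P | q.1 = τ} : Finset _) = ∅ := by
        rw [Finset.filter_eq_empty_iff]
        rintro ⟨τ', y⟩ hq rfl
        rw [hP] at hq
        exact h ⟨hq.1, hq.2.1⟩
      simp [this]
  exact (Nat.not_even_iff_odd.2 hodd) heven

end Scarf

/-! ### From Scarf's lemma to Brouwer's theorem on the simplex. -/

section Brouwer

/-- Dominance forces the coordinatewise minima over the family, summed over `C`, to exceed `N -
C.card`. Each member has total `N`, so less than `C.card` is left for coordinates outside `C` and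
for excess over the minima. -/
lemma dominant_grid_family_close {I : Type*} [Fintype I] {N : ℕ} {C : Finset I} (hC : C.Nonempty)
    {g : I → I → ℕ}
    (hg : ∀ k, ∑ i, g k i = N)
    (hdom : ∀ y : I → ℕ, ∑ i, y i = N → ∃ i ∈ C, ∀ k ∈ C, y i ≤ g k i) {k : I} (hk : k ∈ C) :
    (∀ i ∉ C, g k i ≤ Fintype.card I) ∧ ∀ i ∈ C, ∀ l ∈ C, g k i ≤ g l i + Fintype.card I := by
  classical
  choose μ hμC hμ using fun i => Finset.exists_min_image C (fun k => g k i) hC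
  have hlarge : N < ∑ i ∈ C, (g (μ i) i + 1) := by
    by_contra! hle
    obtain ⟨j, hj⟩ := hC
    -- The test point is one above each minimum on `C`, with the leftover mass placed at `j`; no
    -- coordinate in `C` can block it.
    obtain ⟨i, hi, h⟩ := hdom (fun i => (if i ∈ C then g (μ i) i + 1 else 0) +
      if i = j then N - ∑ i ∈ C, (g (μ i) i + 1) else 0) (by
        rw [Finset.sum_add_distrib, Finset.sum_ite_mem, Finset.univ_inter]
        simp only [Finset.sum_ite_eq', Finset.mem_univ, if_true]
        omega)
    have := h (μ i) (hμC i)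
    simp only [hi, if_true] at this
    omega
  rw [Finset.sum_add_distrib, Finset.sum_const, smul_eq_mul, mul_one] at hlarge
  have hcard : C.card ≤ Fintype.card I := Finset.card_le_univ C
  have hsplit : ∑ i ∈ C, g k i + ∑ i ∈ Cᶜ, g k i = N := by
    rw [Finset.sum_add_sum_compl, hg]
  refine ⟨fun i hi => ?_, fun i hi l hl => ?_⟩
  · have h1 : g k i ≤ ∑ i ∈ Cᶜ, g k i :=
      Finset.single_le_sum (f := fun i => g k i) (fun _ _ => Nat.zero_le _)
        (Finset.mem_compl.2 hi)
    have h2 : ∑ i ∈ C, g (μ i) i ≤ ∑ i ∈ C, g k i := Finset.sum_le_sum fun i _ => hμ i k hk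
    omega
  · have h1 := Finset.add_sum_erase C (fun i => g k i) hi
    have h2 := Finset.add_sum_erase C (fun i => g (μ i) i) hi
    have h3 : ∑ i ∈ C.erase i, g (μ i) i ≤ ∑ i ∈ C.erase i, g k i :=
      Finset.sum_le_sum fun i _ => hμ i k hk
    have h4 := hμ i l hl
    omega

variable {I : Type*} [Fintype I] [Nonempty I]

/-- One slack point per colour is adjoined, and `C` collects the colours represented by ordinary
points. A slack representative of colour `i` is lowest in order `i`, so it cannot lie above an
ordinary point there. Hence ordinary points are blocked only in orders from `C`. -/
lemma exists_colourful_dominant_family {T : Type*} [Fintype T] [Nonempty T] (f : T → I → ℕ)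
    (c : T → I) : ∃ (C : Finset I) (g : I → T), C.Nonempty ∧ (∀ k ∈ C, c (g k) = k) ∧
      ∀ y, ∃ i ∈ C, ∀ k ∈ C, f y i ≤ f (g k) i := by
  classical
  let e : T → ℕ := fun x => Fintype.equivFin T x
  have he : Function.Injective e := fun x y h => (Fintype.equivFin T).injective (Fin.ext h)
  let e' : I → ℕ := fun x => Fintype.equivFin I x
  have he' : Function.Injective e' := fun x y h => (Fintype.equivFin I).injective (Fin.ext h)
  let S : ℕ := ∑ x, ∑ i, f x i
  have hS : ∀ x i, f x i ≤ S := fun x i =>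
    (Finset.single_le_sum (f := fun i => f x i) (fun _ _ => Nat.zero_le _)
      (Finset.mem_univ i)).trans
      (Finset.single_le_sum (f := fun x => ∑ i, f x i) (fun _ _ => Nat.zero_le _)
        (Finset.mem_univ x))
  -- Ordinary first components lie between `1` and `S + 1`, so `0` and `S + 2` place slack points
  -- strictly below and above them. The second component breaks ties.
  let p : I → T ⊕ I → ℕ ×ₗ ℕ := fun i => Sum.elim (fun x => toLex (f x i + 1, e x))
    (fun k => toLex (if k = i then 0 else S + 2, e' k))
  have hp : ∀ i, Function.Injective (p i) := by
    rintro i (x | k) (y | l) h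
    · have := (Prod.ext_iff.1 (toLex.injective h)).2
      rw [he this]
    · have h1 := (Prod.ext_iff.1 (toLex.injective h)).1
      have := hS x i
      dsimp only at h1
      split_ifs at h1
      omega
    · have h1 := (Prod.ext_iff.1 (toLex.injective h)).1
      have := hS y i
      dsimp only at h1
      split_ifs at h1
      omega
    · have := (Prod.ext_iff.1 (toLex.injective h)).2
      rw [he' this]
  have hs : IsSlack p Sum.inr := by
    refine ⟨?_, ?_⟩
    · rintro i (y | l)
      · refine (Prod.Lex.toLex_lt_toLex.2 (Or.inl ?_)).le
        simp
      · by_cases h : l = i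
        · rw [h]
        · refine (Prod.Lex.toLex_lt_toLex.2 (Or.inl ?_)).le
          simp [h]
    · rintro i k (y | l) hk hy
      · refine Prod.Lex.toLex_lt_toLex.2 (Or.inl ?_)
        have := hS y i
        simp only [if_neg hk]
        omega
      · exact absurd ⟨l, rfl⟩ hy
  obtain ⟨σ, -, hσ, hdom⟩ := hs.exists_dominant_colourful hp (c := Sum.elim c id) (fun i => rfl)
  have : ∀ i, ∃ x ∈ σ, Sum.elim c id x = i := fun i =>
    Finset.mem_image.1 (hσ ▸ Finset.mem_univ i)
  choose g hgσ hgc using this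
  obtain ⟨x₀⟩ := ‹Nonempty T›
  let C : Finset I := {k | (g k).isLeft}
  have hC : ∀ k ∈ C, ∃ x, g k = Sum.inl x := fun k hk => Sum.isLeft_iff.1 (by simpa [C] using hk)
  let g' : I → T := fun k => (g k).elim id (fun _ => x₀)
  have hg' : ∀ k ∈ C, g k = Sum.inl (g' k) := by
    intro k hk
    obtain ⟨x, hx⟩ := hC k hk
    simp [g', hx]
  have hlast : ∀ y, ∃ i ∈ C, ∀ k ∈ C, f y i ≤ f (g' k) i := by
    intro y
    obtain ⟨i, hi⟩ := hdom (Sum.inl y)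
    refine ⟨i, ?_, fun k hk => ?_⟩
    · rcases h : g i with x | l
      · simp [C, h]
      · have h1 := hi _ (hgσ i)
        have h2 := hgc i
        rw [h] at h1 h2
        simp only [Sum.elim_inr, id] at h2
        have := Prod.Lex.toLex_le_toLex.1 h1
        simp [h2] at this
    · have h1 := hi _ (hgσ k)
      rw [hg' k hk] at h1
      have := Prod.Lex.toLex_le_toLex.1 h1
      simp only at this
      omega
  refine ⟨C, g', ?_, fun k hk => ?_, hlast⟩
  · obtain ⟨i, hi, -⟩ := hlast x₀
    exact ⟨i, hi⟩
  · have := hgc k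
    rw [hg' k hk] at this
    exact this

/-- A grid point is coloured by a coordinate that `f` does not decrease. The members of a colourful
dominant family are close together, so by uniform continuity one member inherits the inequality for
every colour in `C`. Its coordinates outside `C` are small anyway. -/
lemma exists_approx_fixed_point {f : (I → ℝ) → I → ℝ} (hf : ContinuousOn f (stdSimplex ℝ I))
    (hmaps : Set.MapsTo f (stdSimplex ℝ I) (stdSimplex ℝ I)) {δ : ℝ} (hδ : 0 < δ) :
    ∃ x ∈ stdSimplex ℝ I, ∀ i, x i ≤ f x i + δ := by
  classical
  obtain ⟨η, hη, hunif⟩ := Metric.uniformContinuousOn_iff.1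
    ((isCompact_stdSimplex ℝ I).uniformContinuousOn_of_continuous hf) (δ / 2) (half_pos hδ)
  obtain ⟨N, hN⟩ := exists_nat_gt ((Fintype.card I : ℝ) / min η (δ / 2))
  have hmin : 0 < min η (δ / 2) := lt_min hη (half_pos hδ)
  have hN0 : (0 : ℝ) < N := lt_of_le_of_lt (by positivity) hN
  have hsmall : (Fintype.card I : ℝ) / N < min η (δ / 2) := by
    rw [div_lt_iff₀ hmin] at hN
    rw [div_lt_iff₀ hN0]
    linarith
  let pt : (I → ℕ) → I → ℝ := fun x i => (x i : ℝ) / N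
  have hpt : ∀ x : I → ℕ, ∑ i, x i = N → pt x ∈ stdSimplex ℝ I := by
    refine fun x hx => ⟨fun i => by positivity, ?_⟩
    rw [← Finset.sum_div, ← Nat.cast_sum, hx, div_self hN0.ne']
  have hcol : ∀ x : I → ℕ, ∑ i, x i = N → ∃ i, pt x i ≤ f (pt x) i := by
    intro x hx
    obtain ⟨i, -, hi⟩ := Finset.exists_le_of_sum_le (s := Finset.univ) (f := pt x)
      (g := f (pt x)) Finset.univ_nonempty
      (by rw [(hpt x hx).2, (hmaps (hpt x hx)).2])
    exact ⟨i, hi⟩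
  let T := {x : I → ℕ // x ∈ Finset.piAntidiag Finset.univ N}
  let _ : Fintype T := Finset.Subtype.fintype _
  have hT : ∀ x : T, ∑ i, x.1 i = N := fun x => (Finset.mem_piAntidiag.1 x.2).1
  have hmem : ∀ x : I → ℕ, ∑ i, x i = N → x ∈ Finset.piAntidiag Finset.univ N := fun x hx =>
    Finset.mem_piAntidiag.2 ⟨hx, fun _ _ => Finset.mem_univ _⟩
  choose c hc using fun x : T => hcol x.1 (hT x)
  have : Nonempty T := by
    obtain ⟨j⟩ := ‹Nonempty I›
    exact ⟨⟨Pi.single j N, hmem _ (by simp)⟩⟩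
  obtain ⟨C, g, ⟨k, hk⟩, hgc, hdom⟩ := exists_colourful_dominant_family (fun x : T => x.1) c
  have hclose : ∀ k ∈ C, _ := fun k hk => dominant_grid_family_close ⟨k, hk⟩
    (g := fun k => (g k).1) (fun k => hT (g k)) (fun y hy => hdom ⟨y, hmem y hy⟩) hk
  refine ⟨pt (g k).1, hpt _ (hT _), fun i => ?_⟩
  by_cases hi : i ∈ C
  · have hdist : dist (pt (g i).1) (pt (g k).1) < η := by
      rw [dist_pi_lt_iff hη]
      intro j
      refine lt_of_le_of_lt ?_ (hsmall.trans_le (min_le_left _ _))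
      have h12 : (g i).1 j ≤ (g k).1 j + Fintype.card I ∧
          (g k).1 j ≤ (g i).1 j + Fintype.card I := by
        by_cases hj : j ∈ C
        · exact ⟨(hclose i hi).2 j hj k hk, (hclose k hk).2 j hj i hi⟩
        · exact ⟨((hclose i hi).1 j hj).trans (Nat.le_add_left _ _),
            ((hclose k hk).1 j hj).trans (Nat.le_add_left _ _)⟩
      have h1 : ((g i).1 j : ℝ) ≤ (g k).1 j + Fintype.card I := by exact_mod_cast h12.1
      have h2 : ((g k).1 j : ℝ) ≤ (g i).1 j + Fintype.card I := by exact_mod_cast h12.2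
      rw [Real.dist_eq, ← sub_div, abs_div, abs_of_pos hN0]
      gcongr
      rw [abs_le]
      constructor <;> linarith
    have h1 := (dist_pi_lt_iff (half_pos hδ)).1
      (hunif _ (hpt _ (hT (g i))) _ (hpt _ (hT (g k))) hdist) i
    rw [Real.dist_eq, abs_lt] at h1
    have h2 := hc (g i)
    rw [hgc i hi] at h2
    have h3 : ((g k).1 i : ℝ) ≤ (g i).1 i + Fintype.card I := by
      exact_mod_cast (hclose k hk).2 i hi i hi
    have h4 : pt (g k).1 i ≤ pt (g i).1 i + Fintype.card I / N := by
      simp only [pt]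
      rw [← add_div]
      gcongr
    have h5 := hsmall.trans_le (min_le_right _ _)
    linarith
  · have h3 : ((g k).1 i : ℝ) ≤ Fintype.card I := by exact_mod_cast (hclose k hk).1 i hi
    have h4 : pt (g k).1 i ≤ Fintype.card I / N := by
      simp only [pt]
      gcongr
    have h5 := hsmall.trans_le (min_le_right _ _)
    have h6 := (hmaps (hpt _ (hT (g k)))).1 i
    linarith

/-- **Brouwer's fixed point theorem** for the standard simplex. -/
theorem exists_fixed_point_stdSimplex {f : (I → ℝ) → I → ℝ}
    (hf : ContinuousOn f (stdSimplex ℝ I))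
    (hmaps : Set.MapsTo f (stdSimplex ℝ I) (stdSimplex ℝ I)) :
    ∃ x ∈ stdSimplex ℝ I, f x = x := by
  classical
  -- The largest excess `x i - f x i` attains its minimum. Approximate fixed points make that
  -- minimum nonpositive, and equal coordinate sums then force equality.
  have hψ : ContinuousOn (fun x => Finset.univ.sup' Finset.univ_nonempty
      (fun i => x i - f x i)) (stdSimplex ℝ I) := by
    refine ContinuousOn.finset_sup'_apply _ fun i _ => ?_
    exact (continuous_apply i).continuousOn.sub ((continuous_apply i).comp_continuousOn hf)
  obtain ⟨j⟩ := ‹Nonempty I›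
  obtain ⟨x, hx, hmin⟩ := (isCompact_stdSimplex ℝ I).exists_isMinOn
    ⟨_, single_mem_stdSimplex ℝ j⟩ hψ
  have hle : ∀ i, x i ≤ f x i := by
    refine fun i => le_of_forall_pos_le_add fun δ hδ => ?_
    obtain ⟨y, hy, hyδ⟩ := exists_approx_fixed_point hf hmaps hδ
    have h1 := hmin hy
    have h2 : Finset.univ.sup' Finset.univ_nonempty (fun i => y i - f y i) ≤ δ :=
      Finset.sup'_le _ _ fun i _ => by linarith [hyδ i]
    have h3 := Finset.le_sup' (fun i => x i - f x i) (Finset.mem_univ i)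
    simp only [Set.mem_ofPred_eq] at h1
    linarith
  refine ⟨x, hx, funext fun i => ?_⟩
  have hsum : ∑ i, x i = ∑ i, f x i := by rw [hx.2, (hmaps hx).2]
  exact ((Finset.sum_eq_sum_iff_of_le fun i _ => hle i).1 hsum i (Finset.mem_univ i)).symm

end Brouwer

/-! ### Ky Fan's inequality from Brouwer's theorem. -/

/-- **Ky Fan's minimax inequality**. -/
theorem exists_forall_le_zero_of_concaveOn {E : Type*} [NormedAddCommGroup E] [NormedSpace ℝ E]
    {K : Set E} (hK : IsCompact K) (hconv : Convex ℝ K) (hne : K.Nonempty) {φ : E → E → ℝ}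
    (hlsc : ∀ w ∈ K, LowerSemicontinuousOn (fun x => φ x w) K)
    (hconc : ∀ x ∈ K, ConcaveOn ℝ K (φ x)) (hdiag : ∀ x ∈ K, φ x x ≤ 0) :
    ∃ x ∈ K, ∀ w ∈ K, φ x w ≤ 0 := by
  classical
  by_contra! hno
  choose u huo hu using fun w : K => lowerSemicontinuousOn_iff_preimage_Ioi.1 (hlsc w w.2) 0
  have hu' : ∀ w : K, ∀ x ∈ K, (x ∈ u w ↔ 0 < φ x w) := fun w x hx => by
    have := Set.ext_iff.1 (hu w) x
    simpa [hx] using this.symm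
  obtain ⟨t, ht⟩ := hK.elim_finite_subcover u huo fun x hx => by
    obtain ⟨w, hw, h⟩ := hno x hx
    exact Set.mem_iUnion.2 ⟨⟨w, hw⟩, (hu' ⟨w, hw⟩ x hx).2 h⟩
  obtain ⟨f, hf⟩ := PartitionOfUnity.exists_isSubordinate hK.isClosed (fun w : t => u w.1)
    (fun w => huo w.1) fun x hx => by simpa using ht hx
  have hsum : ∀ x ∈ K, ∑ w, f w x = 1 := fun x hx => by
    rw [← finsum_eq_sum_of_fintype]
    exact f.sum_eq_one hx
  have hpos : ∀ w : t, ∀ x ∈ K, f w x ≠ 0 → 0 < φ x w.1 := fun w x hx h =>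
    (hu' w.1 x hx).1 (hf w (subset_tsupport _ h))
  have : Nonempty t := by
    obtain ⟨x, hx⟩ := hne
    by_contra h
    rw [not_nonempty_iff] at h
    simpa using hsum x hx
  let comb : (t → ℝ) → E := fun a => ∑ w, a w • (w.1.1 : E)
  have hcombK : ∀ a ∈ stdSimplex ℝ t, comb a ∈ K := fun a ha =>
    hconv.sum_mem (fun w _ => ha.1 w) ha.2 fun w _ => w.1.2
  have hcomb : Continuous comb := by fun_prop
  -- At the fixed point, `comb a` is the average of the `w` with its own partition weights, all of
  -- which sit where `φ (comb a) w > 0`. Concavity then contradicts `hdiag`.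
  obtain ⟨a, ha, hfix⟩ := exists_fixed_point_stdSimplex (f := fun a w => f w (comb a))
    (continuous_pi fun w => (f w).continuous.comp hcomb).continuousOn
    (fun a ha => ⟨fun w => f.nonneg w _, hsum _ (hcombK a ha)⟩)
  have hx := hcombK a ha
  have hterm : ∀ w, 0 ≤ a w * φ (comb a) w.1 := fun w => by
    by_cases h : a w = 0
    · simp [h]
    · exact mul_nonneg (ha.1 w) (hpos w _ hx (by rwa [congrFun hfix w])).le
  obtain ⟨w, hw⟩ : ∃ w, a w ≠ 0 := by
    by_contra! h
    simpa [h] using ha.2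
  have h1 : 0 < ∑ w, a w * φ (comb a) w.1 :=
    Finset.sum_pos' (fun w _ => hterm w) ⟨w, Finset.mem_univ _,
      mul_pos (lt_of_le_of_ne (ha.1 w) hw.symm) (hpos w _ hx (by rwa [congrFun hfix w]))⟩
  have h2 := (hconc _ hx).le_map_sum (t := Finset.univ) (w := a) (p := fun w : t => (w.1.1 : E))
    (fun w _ => ha.1 w) ha.2 fun w _ => w.1.2
  simp only [smul_eq_mul] at h2
  exact absurd (h1.trans_le (h2.trans (hdiag _ hx))) (lt_irrefl 0)

/-! ### Carathéodory reduction with costs. -/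

section Caratheodory

variable {ι V : Type*} [Fintype ι] [AddCommGroup V] [Module ℝ V]

/-- One reduction step: a linear relation among the vectors carrying a nonnegative combination
allows a cheaper combination with smaller support. -/
lemma exists_smaller_support_of_not_linearIndepOn {v : ι → V} {ℓ : V →ₗ[ℝ] ℝ}
    (hℓ : ∀ k, 0 < ℓ (v k)) (c : ι → ℝ) {a : ι → ℝ} (ha : ∀ k, 0 ≤ a k)
    (hdep : ¬ LinearIndepOn ℝ v {k | a k ≠ 0}) :
    ∃ b : ι → ℝ, (∀ k, 0 ≤ b k) ∧ ∑ k, b k • v k = ∑ k, a k • v k ∧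
      ∑ k, b k * c k ≤ ∑ k, a k * c k ∧ {k | b k ≠ 0} ⊂ {k | a k ≠ 0} := by
  classical
  obtain ⟨w, hwsupp, hwsum, hwc, j, hj⟩ : ∃ w : ι → ℝ, (∀ k, a k = 0 → w k = 0) ∧
      ∑ k, w k • v k = 0 ∧ ∑ k, w k * c k ≤ 0 ∧ ∃ j, w j ≠ 0 := by
    have : ∃ w : ι → ℝ, (∀ k, a k = 0 → w k = 0) ∧ ∑ k, w k • v k = 0 ∧ ∃ j, w j ≠ 0 := by
      have hset : {k | a k ≠ 0} = (({k | a k ≠ 0} : Finset ι) : Set ι) := by simp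
      rw [hset, linearIndepOn_finset_iff] at hdep
      push Not at hdep
      obtain ⟨g, hg, i, hi, hgi⟩ := hdep
      refine ⟨fun k => if a k ≠ 0 then g k else 0, fun k hk => by simp [hk], ?_, i, ?_⟩
      · rw [← hg, Finset.sum_filter]
        refine Finset.sum_congr rfl fun k _ => ?_
        by_cases h : a k = 0 <;> simp [h]
      · simpa [show a i ≠ 0 by simpa using hi] using hgi
    obtain ⟨w, h1, h2, j, h3⟩ := this
    -- A relation may be negated, so it can be chosen not to raise the cost.
    rcases le_total (∑ k, w k * c k) 0 with h | h
    · exact ⟨w, h1, h2, h, j, h3⟩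
    · exact ⟨fun k => - w k, fun k hk => by simp [h1 k hk], by simp [h2], by simpa using h, j,
        by simpa using h3⟩
  obtain ⟨i, hi⟩ : ∃ i, w i < 0 := by
    by_contra! h
    have h0 : ∑ k, w k * ℓ (v k) = 0 := by
      have := congrArg ℓ hwsum
      simpa using this
    have := (Finset.sum_eq_zero_iff_of_nonneg fun k _ => mul_nonneg (h k) (hℓ k).le).1 h0 j
      (Finset.mem_univ _)
    rcases mul_eq_zero.1 this with h | h
    · exact hj h
    · exact (hℓ j).ne' h
  obtain ⟨m, hm, hmin⟩ := Finset.exists_min_image ({k | w k < 0} : Finset ι)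
    (fun k => a k / (- w k)) ⟨i, by simpa using hi⟩
  simp only [Finset.mem_filter, Finset.mem_univ, true_and] at hm hmin
  have hm' : 0 < - w m := by linarith
  -- This is the largest step along `w` that keeps all coefficients nonnegative; the coefficient at
  -- `m` becomes zero.
  set t := a m / (- w m) with ht
  have ht0 : 0 ≤ t := div_nonneg (ha m) hm'.le
  have htm : a m + t * w m = 0 := by
    rw [ht]
    field_simp [hm.ne]
    simp
  refine ⟨fun k => a k + t * w k, fun k => ?_, ?_, ?_, ?_⟩
  · rcases le_or_gt 0 (w k) with h | h
    · have := mul_nonneg ht0 h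
      linarith [ha k]
    · have := hmin k h
      rw [le_div_iff₀ (by linarith)] at this
      linarith
  · simp only [add_smul, mul_smul, Finset.sum_add_distrib, ← Finset.smul_sum, hwsum, smul_zero,
      add_zero]
  · simp only [add_mul, mul_assoc, Finset.sum_add_distrib, ← Finset.mul_sum]
    have := mul_nonneg ht0 (neg_nonneg.2 hwc)
    linarith
  · refine ⟨fun k hk hk0 => hk ?_, fun h => ?_⟩
    · simp [hk0, hwsupp k hk0]
    · exact h (show a m ≠ 0 from fun h0 => hm.ne (hwsupp m h0)) htm

/-- **Carathéodory's theorem with costs**: a nonnegative combination of vectors in an open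
half-space can be replaced by one that is not more expensive and has independent support. -/
theorem exists_linearIndepOn_combination {v : ι → V} {ℓ : V →ₗ[ℝ] ℝ}
    (hℓ : ∀ k, 0 < ℓ (v k)) (c : ι → ℝ) {a : ι → ℝ} (ha : ∀ k, 0 ≤ a k) :
    ∃ b : ι → ℝ, (∀ k, 0 ≤ b k) ∧ ∑ k, b k • v k = ∑ k, a k • v k ∧
      ∑ k, b k * c k ≤ ∑ k, a k * c k ∧ {k | b k ≠ 0} ⊆ {k | a k ≠ 0} ∧
      LinearIndepOn ℝ v {k | b k ≠ 0} := by
  induction hN : {k | a k ≠ 0}.ncard using Nat.strong_induction_on generalizing a with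
  | _ N ih =>
    by_cases hind : LinearIndepOn ℝ v {k | a k ≠ 0}
    · exact ⟨a, ha, rfl, le_rfl, subset_rfl, hind⟩
    obtain ⟨b, hb, hbv, hbc, hbs⟩ := exists_smaller_support_of_not_linearIndepOn hℓ c ha hind
    obtain ⟨b', h1, h2, h3, h4, h5⟩ := ih _ (hN ▸ Set.ncard_lt_ncard hbs (Set.toFinite _)) hb rfl
    exact ⟨b', h1, h2.trans hbv, h3.trans hbc, h4.trans hbs.1, h5⟩

end Caratheodory

/-! ### Convex hulls in finite dimension. -/

section Hull

lemma sum_eq_sum_of_support_embedding {ι κ M : Type*} [Fintype ι] [Fintype κ] [AddCommMonoid M]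
    {S : Set ι} (e : S ↪ κ) {F' : κ → M} {F : ι → M} (hF : ∀ k ∉ S, F k = 0)
    (he : ∀ k, F' (e k) = F k) (hF' : ∀ j ∉ Set.range e, F' j = 0) :
    ∑ j, F' j = ∑ k, F k := by
  classical
  rw [← Fintype.sum_of_injective e e.injective (fun k : S => F k) F' hF' fun k => (he k).symm]
  exact Fintype.sum_of_injective Subtype.val Subtype.val_injective _ F
    (fun k hk => hF k (by simpa using hk)) fun k => rfl

variable {E : Type*} [AddCommGroup E] [Module ℝ E] [FiniteDimensional ℝ E]

/-- A convex combination of points of `s` can be replaced by one with `dim E + 1` terms that has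
the same value and is not more expensive. -/
lemma exists_fin_combination_cost_le {d : ℕ} (hd : Module.finrank ℝ E = d) {s : Set E} (c : E → ℝ)
    {ι : Type*} [Fintype ι] {a : ι → ℝ} (ha : a ∈ stdSimplex ℝ ι) {z : ι → E}
    (hz : ∀ k, z k ∈ s) :
    ∃ (b : Fin (d + 1) → ℝ) (w : Fin (d + 1) → E), b ∈ stdSimplex ℝ (Fin (d + 1)) ∧
      (∀ k, w k ∈ s) ∧ ∑ k, b k • w k = ∑ k, a k • z k ∧
      ∑ k, b k * c (w k) ≤ ∑ k, a k * c (z k) := by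
  classical
  -- Lifting `z k` to `(z k, 1)` preserves the total weight and bounds the support by `dim (E × ℝ) =
  -- d + 1`.
  obtain ⟨b, hb, hbv, hbc, -, hind⟩ := exists_linearIndepOn_combination
    (v := fun k => ((z k, 1) : E × ℝ)) (ℓ := LinearMap.snd ℝ E ℝ) (fun k => by simp)
    (fun k => c (z k)) ha.1
  set S := {k | b k ≠ 0} with hS
  have hbz : ∑ k, b k • z k = ∑ k, a k • z k := by
    have := congrArg (LinearMap.fst ℝ E ℝ) hbv
    simpa using this
  have hb1 : ∑ k, b k = 1 := by
    have := congrArg (LinearMap.snd ℝ E ℝ) hbv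
    simpa [ha.2] using this
  have hcard : Fintype.card S ≤ Fintype.card (Fin (d + 1)) := by
    have := LinearIndependent.fintype_card_le_finrank hind
    simpa [hd] using this
  obtain ⟨e⟩ := Function.Embedding.nonempty_of_card_le hcard
  obtain ⟨k₀⟩ : Nonempty ι := by
    by_contra h
    rw [not_nonempty_iff] at h
    simp at hb1
  have hS0 : ∀ k ∉ S, b k = 0 := fun k hk => by simpa [hS] using hk
  let b' : Fin (d + 1) → ℝ := Function.extend e (fun k => b k) 0
  -- Unused slots have weight zero but must still hold a point of `s`.
  let w : Fin (d + 1) → E := Function.extend e (fun k => z k) fun _ => z k₀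
  have hb'e : ∀ k, b' (e k) = b k := e.injective.extend_apply _ _
  have hwe : ∀ k, w (e k) = z k := e.injective.extend_apply _ _
  have hb'0 : ∀ j ∉ Set.range e, b' j = 0 := fun j hj => Function.extend_apply' _ _ _ hj
  refine ⟨b', w, ⟨fun j => ?_, ?_⟩, fun j => ?_, ?_, ?_⟩
  · by_cases hj : j ∈ Set.range e
    · obtain ⟨k, rfl⟩ := hj
      rw [hb'e]
      exact hb k
    · exact (hb'0 j hj).ge
  · rw [← hb1]
    exact sum_eq_sum_of_support_embedding e hS0 hb'e hb'0
  · by_cases hj : j ∈ Set.range e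
    · obtain ⟨k, rfl⟩ := hj
      rw [hwe]
      exact hz k
    · have : w j = z k₀ := Function.extend_apply' _ _ _ hj
      rw [this]
      exact hz k₀
  · rw [← hbz]
    exact sum_eq_sum_of_support_embedding e (fun k hk => by simp [hS0 k hk])
      (fun k => by rw [hb'e, hwe])
      fun j hj => by simp [hb'0 j hj]
  · refine le_of_eq_of_le ?_ hbc
    exact sum_eq_sum_of_support_embedding e (fun k hk => by simp [hS0 k hk])
      (fun k => by rw [hb'e, hwe])
      fun j hj => by simp [hb'0 j hj]

lemma exists_fin_combination_of_mem_convexHull {d : ℕ} (hd : Module.finrank ℝ E = d) {s : Set E}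
    {x : E} (hx : x ∈ convexHull ℝ s) :
    ∃ (b : Fin (d + 1) → ℝ) (w : Fin (d + 1) → E), b ∈ stdSimplex ℝ (Fin (d + 1)) ∧
      (∀ k, w k ∈ s) ∧ x = ∑ k, b k • w k := by
  obtain ⟨ι, _, a, z, ha, ha1, hz, rfl⟩ := mem_convexHull_iff_exists_fintype.1 hx
  obtain ⟨b, w, h1, h2, h3, -⟩ := exists_fin_combination_cost_le hd (fun _ => 0) ⟨ha, ha1⟩ hz
  exact ⟨b, w, h1, h2, h3.symm⟩

lemma isCompact_convexHull_of_finiteDimensional [TopologicalSpace E] [ContinuousAdd E]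
    [ContinuousSMul ℝ E] {s : Set E} (hs : IsCompact s) : IsCompact (convexHull ℝ s) := by
  have : convexHull ℝ s = (fun p : (Fin (Module.finrank ℝ E + 1) → ℝ) ×
      (Fin (Module.finrank ℝ E + 1) → E) => ∑ k, p.1 k • p.2 k) ''
        (stdSimplex ℝ _ ×ˢ Set.univ.pi fun _ => s) := by
    ext x
    constructor
    · intro hx
      obtain ⟨b, w, hb, hw, rfl⟩ := exists_fin_combination_of_mem_convexHull rfl hx
      exact ⟨(b, w), ⟨hb, fun k _ => hw k⟩, rfl⟩
    · rintro ⟨⟨b, w⟩, ⟨hb, hw⟩, rfl⟩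
      exact mem_convexHull_of_exists_fintype b w hb.1 hb.2 (fun k => hw k trivial) rfl
  rw [this]
  exact ((isCompact_stdSimplex ℝ _).prod (isCompact_univ_pi fun _ => hs)).image (by fun_prop)

end Hull

lemma LowerSemicontinuousOn.continuousOn_mul {P : Type*} [TopologicalSpace P] {S : Set P}
    {a f : P → ℝ} (hf : LowerSemicontinuousOn f S) (ha : ContinuousOn a S)
    (ha0 : ∀ p ∈ S, 0 ≤ a p) (hf0 : ∀ p ∈ S, 0 ≤ f p) :
    LowerSemicontinuousOn (fun p => a p * f p) S := by
  intro p hp y hy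
  change y < a p * f p at hy
  rcases lt_or_ge y 0 with h0 | h0
  · filter_upwards [self_mem_nhdsWithin] with q hq
    exact h0.trans_le (mul_nonneg (ha0 q hq) (hf0 q hq))
  have hpos : 0 < a p * f p := h0.trans_lt hy
  have hap : 0 < a p := (pos_iff_pos_of_mul_pos hpos).2
    (lt_of_le_of_ne (hf0 p hp) fun h => by simp [← h] at hpos)
  obtain ⟨t, hyt, htf⟩ := exists_between ((div_lt_iff₀' hap).2 hy)
  have ht : 0 ≤ t := (div_nonneg h0 hap.le).trans hyt.le
  have h1 : ∀ᶠ q in 𝓝[S] p, y < a q * t := by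
    have : Filter.Tendsto (fun q => a q * t) (𝓝[S] p) (𝓝 (a p * t)) :=
      (ha p hp).tendsto.mul_const t
    exact this.eventually_const_lt ((div_lt_iff₀' hap).1 hyt)
  filter_upwards [h1, hf p hp t htf, self_mem_nhdsWithin] with q hq1 hq2 hq
  exact hq1.trans_le (mul_le_mul_of_nonneg_left (le_of_lt hq2) (ha0 q hq))

/-! ### Equilibria of the convexified game. -/

namespace Game

variable {n d : ℕ}

/-- The profiles of the convexified game. -/
def profiles (G : Game n d) : Set (Fin n → EuclideanSpace ℝ (Fin d)) :=
  Set.univ.pi fun i => convexHull ℝ (G.action i)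

lemma mem_profiles {G : Game n d} {x : Fin n → EuclideanSpace ℝ (Fin d)} :
    x ∈ G.profiles ↔ ∀ i, x i ∈ convexHull ℝ (G.action i) := by
  simp [profiles]

lemma update_mem_profiles {G : Game n d} {x : Fin n → EuclideanSpace ℝ (Fin d)}
    (hx : x ∈ G.profiles) {i : Fin n} {u : EuclideanSpace ℝ (Fin d)}
    (hu : u ∈ convexHull ℝ (G.action i)) : Function.update x i u ∈ G.profiles := by
  rw [mem_profiles] at hx ⊢
  intro j
  by_cases h : j = i
  · subst h
    simpa using hu
  · simpa [h] using hx j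

/-- Compact action sets, costs lower semicontinuous in the own action and the profile jointly, and
continuous in the actions of the others. -/
structure IsRegular (G : Game n d) : Prop where
  nonempty : ∀ i, (G.action i).Nonempty
  compact : ∀ i, IsCompact (G.action i)
  lsc : ∀ i, LowerSemicontinuousOn
    (fun p : (Fin n → EuclideanSpace ℝ (Fin d)) × EuclideanSpace ℝ (Fin d) =>
      G.cost i (Function.update p.1 i p.2)) (G.profiles ×ˢ G.action i)
  cont : ∀ i, ∀ z ∈ G.action i,
    ContinuousOn (fun x => G.cost i (Function.update x i z)) G.profiles

lemma isDecomposition_update_iff {G : Game n d} {i : Fin n}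
    {x : Fin n → EuclideanSpace ℝ (Fin d)} {u : EuclideanSpace ℝ (Fin d)} {α : Fin (d + 1) → ℝ}
    {z : Fin (d + 1) → EuclideanSpace ℝ (Fin d)} :
    G.IsDecomposition i (Function.update x i u) α z ↔
      α ∈ stdSimplex ℝ (Fin (d + 1)) ∧ (∀ k, z k ∈ G.action i) ∧ u = ∑ k, α k • z k := by
  simp [IsDecomposition]

lemma decompositionCost_update (G : Game n d) (i : Fin n)
    (x : Fin n → EuclideanSpace ℝ (Fin d)) (u : EuclideanSpace ℝ (Fin d)) (α : Fin (d + 1) → ℝ)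
    (z : Fin (d + 1) → EuclideanSpace ℝ (Fin d)) :
    G.decompositionCost i (Function.update x i u) α z = G.decompositionCost i x α z := by
  simp [decompositionCost]

lemma convexified_cost_eq {G : Game n d} {i : Fin n} {x : Fin n → EuclideanSpace ℝ (Fin d)}
    {α : Fin (d + 1) → ℝ} {z : Fin (d + 1) → EuclideanSpace ℝ (Fin d)}
    (h : G.IsDecomposition i x α z)
    (hmin : ∀ β w, G.IsDecomposition i x β w →
      G.decompositionCost i x α z ≤ G.decompositionCost i x β w) :
    G.convexified.cost i x = G.decompositionCost i x α z := by
  refine IsLeast.csInf_eq ⟨⟨α, z, h, rfl⟩, ?_⟩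
  rintro c ⟨β, w, hd, rfl⟩
  exact hmin β w hd

/-- The pairs of a profile and a decomposition of its `i`-th entry. -/
def decompositionGraph (G : Game n d) (i : Fin n) : Set ((Fin n → EuclideanSpace ℝ (Fin d)) ×
    (Fin (d + 1) → ℝ) × (Fin (d + 1) → EuclideanSpace ℝ (Fin d))) :=
  {p | p.1 ∈ G.profiles ∧ G.IsDecomposition i p.1 p.2.1 p.2.2}

namespace IsRegular

variable {G : Game n d} (hG : G.IsRegular)
include hG

lemma isCompact_profiles : IsCompact G.profiles :=
  isCompact_univ_pi fun i => isCompact_convexHull_of_finiteDimensional (hG.compact i)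

lemma isCompact_decompositionGraph (i : Fin n) : IsCompact (G.decompositionGraph i) := by
  have : G.decompositionGraph i = (G.profiles ×ˢ (stdSimplex ℝ (Fin (d + 1)) ×ˢ
      Set.univ.pi fun _ => G.action i)) ∩ {p | p.1 i = ∑ k, p.2.1 k • p.2.2 k} := by
    ext p
    simp [decompositionGraph, IsDecomposition, and_assoc]
  rw [this]
  refine (hG.isCompact_profiles.prod ((isCompact_stdSimplex ℝ _).prod
    (isCompact_univ_pi fun _ => hG.compact i))).inter_right (isClosed_eq ?_ ?_)
  · fun_prop
  · fun_prop

lemma lowerSemicontinuousOn_decompositionCost (i : Fin n) :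
    LowerSemicontinuousOn (fun p : (Fin n → EuclideanSpace ℝ (Fin d)) ×
      (Fin (d + 1) → ℝ) × (Fin (d + 1) → EuclideanSpace ℝ (Fin d)) =>
        G.decompositionCost i p.1 p.2.1 p.2.2) (G.decompositionGraph i) := by
  -- Multiplication by a weight that may vanish preserves lower semicontinuity for nonnegative
  -- functions. Costs are shifted by a lower bound `B`, which is restored at the end because the
  -- weights sum to 1.
  obtain ⟨B, hB⟩ := LowerSemicontinuousOn.bddBelow_of_isCompact
    (hG.isCompact_profiles.prod (hG.compact i)) (hG.lsc i)
  have hB' : ∀ p ∈ G.decompositionGraph i, ∀ k,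
      0 ≤ G.cost i (Function.update p.1 i (p.2.2 k)) + -B := fun p hp k => by
    have : B ≤ G.cost i (Function.update p.1 i (p.2.2 k)) :=
      hB ⟨(p.1, p.2.2 k), ⟨hp.1, hp.2.2.1 k⟩, rfl⟩
    linarith
  have h1 : LowerSemicontinuousOn (fun p : (Fin n → EuclideanSpace ℝ (Fin d)) ×
      (Fin (d + 1) → ℝ) × (Fin (d + 1) → EuclideanSpace ℝ (Fin d)) =>
        ∑ k, p.2.1 k * (G.cost i (Function.update p.1 i (p.2.2 k)) + -B))
      (G.decompositionGraph i) := by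
    refine lowerSemicontinuousOn_sum fun k _ => LowerSemicontinuousOn.continuousOn_mul ?_
      (by fun_prop) (fun p hp => hp.2.1.1 k) fun p hp => hB' p hp k
    refine LowerSemicontinuousOn.add ?_ continuousOn_const.lowerSemicontinuousOn
    exact LowerSemicontinuousOn.comp (g := fun p : (Fin n → EuclideanSpace ℝ (Fin d)) ×
      (Fin (d + 1) → ℝ) × (Fin (d + 1) → EuclideanSpace ℝ (Fin d)) => (p.1, p.2.2 k))
      (hG.lsc i) (by fun_prop) fun p hp => ⟨hp.1, hp.2.2.1 k⟩
  have h2 := h1.add (continuousOn_const (c := B)).lowerSemicontinuousOn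
  refine fun p hp => LowerSemicontinuousWithinAt.congr_of_eventuallyEq (h2 p hp) hp ?_
  filter_upwards [self_mem_nhdsWithin] with q hq
  have := hq.2.1.2
  simp only [mul_add, Finset.sum_add_distrib, ← Finset.sum_mul, this, decompositionCost]
  ring

lemma exists_minimal_decomposition (i : Fin n) {x : Fin n → EuclideanSpace ℝ (Fin d)}
    (hx : x ∈ G.profiles) : ∃ α z, G.IsDecomposition i x α z ∧
      ∀ β w, G.IsDecomposition i x β w →
        G.decompositionCost i x α z ≤ G.decompositionCost i x β w := by
  have hcl : IsClosed {p : (Fin n → EuclideanSpace ℝ (Fin d)) ×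
      (Fin (d + 1) → ℝ) × (Fin (d + 1) → EuclideanSpace ℝ (Fin d)) | p.1 = x} :=
    isClosed_eq continuous_fst continuous_const
  obtain ⟨b, w, hb, hw, hxw⟩ := exists_fin_combination_of_mem_convexHull (d := d) (by simp)
    (mem_profiles.1 hx i)
  obtain ⟨⟨x', α, z⟩, ⟨hp, rfl⟩, hmin⟩ := LowerSemicontinuousOn.exists_isMinOn
    (s := G.decompositionGraph i ∩ {p | p.1 = x}) ⟨(x, b, w), ⟨hx, hb, hw, hxw⟩, rfl⟩
    ((hG.isCompact_decompositionGraph i).inter_right hcl)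
    ((hG.lowerSemicontinuousOn_decompositionCost i).mono Set.inter_subset_left)
  exact ⟨α, z, hp.2, fun β w h => isMinOn_iff.1 hmin (x', β, w) ⟨⟨hx, h⟩, rfl⟩⟩

lemma convexified_cost_le {i : Fin n} {x : Fin n → EuclideanSpace ℝ (Fin d)}
    (hx : x ∈ G.profiles) {α : Fin (d + 1) → ℝ} {z : Fin (d + 1) → EuclideanSpace ℝ (Fin d)}
    (h : G.IsDecomposition i x α z) :
    G.convexified.cost i x ≤ G.decompositionCost i x α z := by
  obtain ⟨β, w, h1, h2⟩ := hG.exists_minimal_decomposition i hx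
  rw [convexified_cost_eq h1 h2]
  exact h2 _ _ h

lemma exists_convexified_cost_eq (i : Fin n) {x : Fin n → EuclideanSpace ℝ (Fin d)}
    (hx : x ∈ G.profiles) : ∃ α z, G.IsDecomposition i x α z ∧
      G.convexified.cost i x = G.decompositionCost i x α z := by
  obtain ⟨β, w, h1, h2⟩ := hG.exists_minimal_decomposition i hx
  exact ⟨β, w, h1, convexified_cost_eq h1 h2⟩

/-- Optimal decompositions of `u` and `v` merge into one with `2 * (d + 1)` points and the averaged
cost. The Carathéodory reduction with costs brings it back to `d + 1` points. -/
lemma convexOn_convexified_cost (i : Fin n) {x : Fin n → EuclideanSpace ℝ (Fin d)}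
    (hx : x ∈ G.profiles) : ConvexOn ℝ (convexHull ℝ (G.action i))
      fun u => G.convexified.cost i (Function.update x i u) := by
  refine ⟨convex_convexHull ℝ _, fun u hu v hv a b ha hb hab => ?_⟩
  obtain ⟨α, z, h1, h2⟩ := hG.exists_convexified_cost_eq i (update_mem_profiles hx hu)
  obtain ⟨β, w, h3, h4⟩ := hG.exists_convexified_cost_eq i (update_mem_profiles hx hv)
  have huv := convex_convexHull ℝ (G.action i) hu hv ha hb hab
  rw [isDecomposition_update_iff] at h1 h3
  rw [decompositionCost_update] at h2 h4
  obtain ⟨c, y, hc, hy, hsum, hcost⟩ := exists_fin_combination_cost_le (d := d) (by simp)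
    (s := G.action i) (fun p => G.cost i (Function.update x i p))
    (a := Sum.elim (fun k => a * α k) fun k => b * β k) (z := Sum.elim z w)
    ⟨by
      rintro (k | k)
      · exact mul_nonneg ha (h1.1.1 k)
      · exact mul_nonneg hb (h3.1.1 k), by
      simp [Fintype.sum_sum_type, ← Finset.mul_sum, h1.1.2, h3.1.2, hab]⟩
    (by
      rintro (k | k)
      · exact h1.2.1 k
      · exact h3.2.1 k)
  simp only [Fintype.sum_sum_type, Sum.elim_inl, Sum.elim_inr, mul_smul, mul_assoc,
    ← Finset.smul_sum, ← Finset.mul_sum] at hsum hcost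
  rw [← h1.2.2, ← h3.2.2] at hsum
  have hdec : G.IsDecomposition i (Function.update x i (a • u + b • v)) c y :=
    isDecomposition_update_iff.2 ⟨hc, hy, hsum.symm⟩
  refine (hG.convexified_cost_le (update_mem_profiles hx huv) hdec).trans ?_
  change _ ≤ a • G.convexified.cost i (Function.update x i u) +
    b • G.convexified.cost i (Function.update x i v)
  rw [decompositionCost_update, h2, h4]
  exact hcost

/-- Since minima are attained, sublevel sets are projections of compact sublevel sets in the
decomposition graph. -/
lemma lowerSemicontinuousOn_convexified_cost (i : Fin n) :
    LowerSemicontinuousOn (G.convexified.cost i) G.profiles := by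
  rw [lowerSemicontinuousOn_iff_preimage_Iic]
  intro b
  refine ⟨_, (((hG.lowerSemicontinuousOn_decompositionCost i).isCompact_inter_preimage_Iic
    (hG.isCompact_decompositionGraph i) b).image continuous_fst).isClosed, ?_⟩
  ext x
  constructor
  · rintro ⟨hx, hxb⟩
    obtain ⟨α, z, h1, h2⟩ := hG.exists_convexified_cost_eq i hx
    refine ⟨hx, (x, α, z), ⟨⟨hx, h1⟩, ?_⟩, rfl⟩
    change G.decompositionCost i x α z ≤ b
    rw [← h2]
    exact hxb
  · rintro ⟨hx, ⟨x', α, z⟩, ⟨hp, hb⟩, rfl⟩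
    exact ⟨hx, (hG.convexified_cost_le hx hp.2).trans hb⟩

/-- An optimal decomposition of the fixed action `u` stays feasible when the profile moves, and its
cost varies continuously. It bounds the convexified cost from above nearby. -/
lemma lowerSemicontinuousOn_neg_convexified_cost_update (i : Fin n)
    {u : EuclideanSpace ℝ (Fin d)} (hu : u ∈ convexHull ℝ (G.action i)) :
    LowerSemicontinuousOn (fun x => -G.convexified.cost i (Function.update x i u))
      G.profiles := by
  intro x hx y hy
  change y < -G.convexified.cost i (Function.update x i u) at hy
  obtain ⟨α, z, h1, h2⟩ := hG.exists_convexified_cost_eq i (update_mem_profiles hx hu)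
  have hcont : ContinuousOn (fun x => G.decompositionCost i x α z) G.profiles :=
    continuousOn_finsetSum _ fun k _ => (hG.cont i (z k) (h1.2.1 k)).const_mul (α k)
  rw [h2, decompositionCost_update] at hy
  filter_upwards [(hcont x hx).eventually_lt_const (u := -y) (by linarith),
    self_mem_nhdsWithin] with x' hx' hx'K
  have := hG.convexified_cost_le (update_mem_profiles hx'K hu)
    (isDecomposition_update_iff.2 (isDecomposition_update_iff.1 h1))
  rw [decompositionCost_update] at this
  linarith

theorem exists_isPNE_convexified : ∃ y, G.convexified.IsPNE y := by
  have hconv : Convex ℝ G.profiles := convex_pi fun i _ => convex_convexHull ℝ _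
  choose a ha using hG.nonempty
  obtain ⟨x, hx, h⟩ := exists_forall_le_zero_of_concaveOn hG.isCompact_profiles hconv
    ⟨a, mem_profiles.2 fun i => subset_convexHull ℝ _ (ha i)⟩
    -- The Nikaido–Isoda function: the total gain when each player deviates alone to `w i`. Testing
    -- it at a unilateral deviation isolates one player.
    (φ := fun x w => ∑ i, (G.convexified.cost i x +
      -G.convexified.cost i (Function.update x i (w i))))
    (fun w hw => lowerSemicontinuousOn_sum fun i _ =>
      (hG.lowerSemicontinuousOn_convexified_cost i).add
        (hG.lowerSemicontinuousOn_neg_convexified_cost_update i (mem_profiles.1 hw i)))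
    (fun x hx => ⟨hconv, fun w hw w' hw' a b ha hb hab => by
      simp only [Finset.smul_sum, ← Finset.sum_add_distrib]
      refine Finset.sum_le_sum fun i _ => ?_
      have := (hG.convexOn_convexified_cost i hx).2 (mem_profiles.1 hw i)
        (mem_profiles.1 hw' i) ha hb hab
      simp only [smul_eq_mul] at this ⊢
      simp only [Pi.add_apply, Pi.smul_apply]
      have h1 : a * G.convexified.cost i x + b * G.convexified.cost i x =
        G.convexified.cost i x := by rw [← add_mul, hab, one_mul]
      linarith⟩)
    (fun x _ => by simp)
  refine ⟨x, mem_profiles.1 hx, fun i z hz => ?_⟩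
  have := h (Function.update x i z) (update_mem_profiles hx hz)
  rw [Finset.sum_eq_single i (fun j _ hj => by simp [hj]) (by simp)] at this
  simp only [Function.update_self] at this
  linarith

end IsRegular

end Game

/-! ### The Shapley–Folkman–Starr theorem. -/

section ShapleyFolkman

variable {J K F : Type*} [Fintype K] [NormedAddCommGroup F] [InnerProductSpace ℝ F]

/-- Among the points carrying positive weight, one deviates from a given vector by at most the
mean square deviation. -/
lemma exists_pos_weight_norm_sq_le {b : K → ℝ} (hb : b ∈ stdSimplex ℝ K) (p : K → F) (r : F) :
    ∃ k, 0 < b k ∧ ‖r + (∑ l, b l • p l - p k)‖ ^ 2 ≤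
      ‖r‖ ^ 2 + ∑ k, b k * ‖∑ l, b l • p l - p k‖ ^ 2 := by
  by_contra! h
  set Y := ∑ l, b l • p l with hY
  have hzero : ∑ k, b k • (Y - p k) = 0 := by
    simp only [smul_sub, Finset.sum_sub_distrib, ← Finset.sum_smul, hb.2, one_smul]
    simp [hY]
  -- The deviations average to zero, so the cross terms cancel.
  have hmean : ∑ k, b k * ‖r + (Y - p k)‖ ^ 2 = ‖r‖ ^ 2 + ∑ k, b k * ‖Y - p k‖ ^ 2 := by
    have h1 : ∀ k, b k * ‖r + (Y - p k)‖ ^ 2 =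
        b k * ‖r‖ ^ 2 + 2 * inner ℝ r (b k • (Y - p k)) + b k * ‖Y - p k‖ ^ 2 := fun k => by
      rw [norm_add_sq_real, inner_smul_right]
      ring
    simp only [h1, Finset.sum_add_distrib, ← Finset.sum_mul, ← Finset.mul_sum, ← inner_sum,
      hzero, hb.2]
    simp
  obtain ⟨k₀, hk₀⟩ : ∃ k, 0 < b k := by
    by_contra! h0
    have := Finset.sum_nonpos fun k (_ : k ∈ Finset.univ) => h0 k
    rw [hb.2] at this
    linarith
  have hlt : ∑ k, b k * (‖r‖ ^ 2 + ∑ k, b k * ‖Y - p k‖ ^ 2) <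
      ∑ k, b k * ‖r + (Y - p k)‖ ^ 2 := by
    refine Finset.sum_lt_sum (fun k _ => ?_)
      ⟨k₀, Finset.mem_univ _, mul_lt_mul_of_pos_left (h k₀ hk₀) hk₀⟩
    rcases (hb.1 k).eq_or_lt with h0 | h0
    · simp [← h0]
    · exact mul_le_mul_of_nonneg_left (h k h0).le h0.le
  rw [← Finset.sum_mul, hb.2, one_mul, hmean] at hlt
  exact lt_irrefl _ hlt

/-- Greedy choice: each new point is picked against the accumulated residual, so only the variances
add up. -/
lemma exists_selection_norm_sq_le {b : J → K → ℝ} (hb : ∀ j, b j ∈ stdSimplex ℝ K)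
    (p : J → K → F) (s : Finset J) :
    ∃ κ : J → K, (∀ j, 0 < b j (κ j)) ∧
      ‖∑ j ∈ s, (∑ l, b j l • p j l - p j (κ j))‖ ^ 2 ≤
        ∑ j ∈ s, ∑ k, b j k * ‖∑ l, b j l • p j l - p j k‖ ^ 2 := by
  classical
  induction s using Finset.induction_on with
  | empty =>
    choose κ hκ using fun j => exists_pos_weight_norm_sq_le (hb j) (p j) 0
    exact ⟨κ, fun j => (hκ j).1, by simp⟩
  | insert i s hi ih =>
    obtain ⟨κ, hκ, hle⟩ := ih
    obtain ⟨k, hk, hk'⟩ := exists_pos_weight_norm_sq_le (hb i) (p i)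
      (∑ j ∈ s, (∑ l, b j l • p j l - p j (κ j)))
    refine ⟨Function.update κ i k, fun j => ?_, ?_⟩
    · by_cases h : j = i
      · subst h
        simpa using hk
      · simpa [h] using hκ j
    · have hs : ∑ j ∈ s, (∑ l, b j l • p j l - p j (Function.update κ i k j)) =
          ∑ j ∈ s, (∑ l, b j l • p j l - p j (κ j)) := by
        refine Finset.sum_congr rfl fun j hj => ?_
        rw [Function.update_of_ne (ne_of_mem_of_not_mem hj hi)]
      rw [Finset.sum_insert hi, Finset.sum_insert hi, hs, Function.update_self, add_comm]
      linarith

lemma norm_mean_sub_le {b : K → ℝ} (hb : b ∈ stdSimplex ℝ K) {p : K → F} {D : ℝ}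
    (hD : ∀ k l, ‖p k - p l‖ ≤ D) (k : K) : ‖∑ l, b l • p l - p k‖ ≤ D := by
  have h1 : ∑ l, b l • p l - p k = ∑ l, b l • (p l - p k) := by
    simp only [smul_sub, Finset.sum_sub_distrib, ← Finset.sum_smul, hb.2, one_smul]
  rw [h1]
  calc ‖∑ l, b l • (p l - p k)‖ ≤ ∑ l, b l * D := by
        refine norm_sum_le_of_le _ fun l _ => ?_
        rw [norm_smul, Real.norm_of_nonneg (hb.1 l)]
        exact mul_le_mul_of_nonneg_left (hD l k) (hb.1 l)
    _ = D := by rw [← Finset.sum_mul, hb.2, one_mul]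

open Classical in
-- A single support point has zero variance; with at least two, the factor `card - 1` is at least 1.
-- Summed over `j`, this form turns the support bound into `dim F`.
lemma variance_le_card_support {b : K → ℝ} (hb : b ∈ stdSimplex ℝ K) {p : K → F} {D : ℝ}
    (hD : ∀ k l, ‖p k - p l‖ ≤ D) :
    ∑ k, b k * ‖∑ l, b l • p l - p k‖ ^ 2 ≤
      ((({k | b k ≠ 0} : Finset K).card : ℝ) - 1) * D ^ 2 := by
  have hne : ({k | b k ≠ 0} : Finset K).Nonempty := by
    rw [Finset.nonempty_iff_ne_empty]
    intro h
    rw [Finset.filter_eq_empty_iff] at h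
    have h1 := hb.2
    rw [Finset.sum_eq_zero fun k hk => not_not.1 (h hk)] at h1
    exact zero_ne_one h1
  rcases (Nat.one_le_iff_ne_zero.2 (Finset.card_pos.2 hne).ne').eq_or_lt with h | h
  · rw [← h, Nat.cast_one, sub_self, zero_mul]
    refine (Finset.sum_eq_zero fun k _ => ?_).le
    by_cases hk : b k = 0
    · simp [hk]
    have hY : ∑ l, b l • p l - p k = ∑ l, b l • (p l - p k) := by
      simp only [smul_sub, Finset.sum_sub_distrib, ← Finset.sum_smul, hb.2, one_smul]
    rw [hY, Finset.sum_eq_zero, norm_zero]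
    · simp
    intro l _
    by_cases hl : b l = 0
    · simp [hl]
    · rw [Finset.card_le_one.1 h.ge l (by simpa using hl) k (by simpa using hk)]
      simp
  · have h2 : (2 : ℝ) ≤ ({k | b k ≠ 0} : Finset K).card := by exact_mod_cast h
    calc ∑ k, b k * ‖∑ l, b l • p l - p k‖ ^ 2 ≤ ∑ k, b k * D ^ 2 := by
          refine Finset.sum_le_sum fun k _ => mul_le_mul_of_nonneg_left ?_ (hb.1 k)
          exact pow_le_pow_left₀ (norm_nonneg _) (norm_mean_sub_le hb hD k) 2
      _ = D ^ 2 := by rw [← Finset.sum_mul, hb.2, one_mul]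
      _ ≤ _ := le_mul_of_one_le_left (sq_nonneg D) (by linarith)

variable [Fintype J] [FiniteDimensional ℝ F]

open Classical in
/-- **Shapley–Folkman lemma**: the weights of a sum of convex combinations can be changed without
changing the sum so that all but `dim F` of the combinations become trivial. -/
lemma exists_weights_card_support_le {a : J → K → ℝ} (ha : ∀ j, a j ∈ stdSimplex ℝ K)
    (p : J → K → F) :
    ∃ b : J → K → ℝ, (∀ j, b j ∈ stdSimplex ℝ K) ∧ (∀ j k, a j k = 0 → b j k = 0) ∧
      ∑ j, ∑ k, b j k • p j k = ∑ j, ∑ k, a j k • p j k ∧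
      ∑ j, ({k | b j k ≠ 0} : Finset K).card ≤ Module.finrank ℝ F + Fintype.card J := by
  -- The component `Pi.single q.1 1` records the total weight of each summand, so every summand
  -- stays a convex combination. Independence bounds the support by the dimension of `F × (J → ℝ)`.
  obtain ⟨b, hb, hbv, -, hsupp, hind⟩ := exists_linearIndepOn_combination
    (v := fun q : J × K => ((p q.1 q.2, Pi.single q.1 1) : F × (J → ℝ)))
    (ℓ := (∑ j, LinearMap.proj j) ∘ₗ LinearMap.snd ℝ F (J → ℝ))
    (fun q => by simp) (fun _ => 0) (a := fun q => a q.1 q.2) (fun q => (ha q.1).1 q.2)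
  refine ⟨fun j k => b (j, k), fun j => ⟨fun k => hb _, ?_⟩, fun j k h => ?_, ?_, ?_⟩
  · have h1 := congrFun (congrArg (LinearMap.snd ℝ F (J → ℝ)) hbv) j
    simpa [Fintype.sum_prod_type, Pi.single_apply, (ha j).2] using h1
  · by_contra hne
    exact hsupp (show b (j, k) ≠ 0 from hne) h
  · have h1 := congrArg (LinearMap.fst ℝ F (J → ℝ)) hbv
    simpa [Fintype.sum_prod_type] using h1
  · have h1 := LinearIndependent.fintype_card_le_finrank hind
    rw [Module.finrank_prod, Module.finrank_fintype_fun_eq_card, Fintype.card_ofFinset] at h1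
    simpa [Finset.card_filter, Fintype.sum_prod_type] using h1

/-- The **Shapley–Folkman–Starr theorem**: a sum of convex combinations is approximated by a sum of
points carrying positive weights, with an error that does not grow with the number of summands. -/
theorem exists_selection_norm_le {a : J → K → ℝ} (ha : ∀ j, a j ∈ stdSimplex ℝ K)
    {p : J → K → F} {D : ℝ} (hD0 : 0 ≤ D) (hD : ∀ j k l, ‖p j k - p j l‖ ≤ D) :
    ∃ κ : J → K, (∀ j, 0 < a j (κ j)) ∧
      ‖∑ j, ∑ k, a j k • p j k - ∑ j, p j (κ j)‖ ≤ √(Module.finrank ℝ F) * D := by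
  classical
  obtain ⟨b, hb, hsupp, hsum, hcard⟩ := exists_weights_card_support_le ha p
  obtain ⟨κ, hκ, hle⟩ := exists_selection_norm_sq_le hb p Finset.univ
  refine ⟨κ, fun j => lt_of_le_of_ne ((ha j).1 _) fun h => (hκ j).ne' (hsupp j _ h.symm), ?_⟩
  rw [Finset.sum_sub_distrib, hsum] at hle
  have h1 : ∑ j, ∑ k, b j k * ‖∑ l, b j l • p j l - p j k‖ ^ 2 ≤
      ∑ j : J, ((({k | b j k ≠ 0} : Finset K).card : ℝ) - 1) * D ^ 2 :=
    Finset.sum_le_sum fun j _ => variance_le_card_support (hb j) (hD j)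
  have h2 : (∑ j, (({k | b j k ≠ 0} : Finset K).card : ℝ)) ≤
      Module.finrank ℝ F + Fintype.card J := by exact_mod_cast hcard
  rw [← Finset.sum_mul, Finset.sum_sub_distrib] at h1
  simp only [Finset.sum_const, Finset.card_univ, nsmul_eq_mul, mul_one] at h1
  refine (sq_le_sq₀ (norm_nonneg _) (by positivity)).1 ?_
  rw [mul_pow, Real.sq_sqrt (Nat.cast_nonneg _)]
  refine hle.trans (h1.trans (mul_le_mul_of_nonneg_right ?_ (sq_nonneg D)))
  linarith

end ShapleyFolkman

/-! ### Generators as sets of best replies. -/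

namespace Game

variable {n d : ℕ} {G : Game n d}

lemma IsGenerator.finite {i : Fin n} {y : Fin n → EuclideanSpace ℝ (Fin d)}
    {Z : Set (EuclideanSpace ℝ (Fin d))} (h : G.IsGenerator i y Z) : Z.Finite := by
  obtain ⟨α, z, -, -, rfl⟩ := h
  refine (Set.finite_range z).subset ?_
  rintro p ⟨k, -, rfl⟩
  exact ⟨k, rfl⟩

lemma IsGenerator.nonempty {i : Fin n} {y : Fin n → EuclideanSpace ℝ (Fin d)}
    {Z : Set (EuclideanSpace ℝ (Fin d))} (h : G.IsGenerator i y Z) : Z.Nonempty := by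
  obtain ⟨α, z, hd, -, rfl⟩ := h
  by_contra hne
  have h0 : ∀ k, α k ≤ 0 := fun k => not_lt.1 fun hk => hne ⟨z k, k, hk, rfl⟩
  have := Finset.sum_nonpos fun k (_ : k ∈ Finset.univ) => h0 k
  rw [hd.1.2] at this
  linarith

lemma IsGenerator.subset_action {i : Fin n} {y : Fin n → EuclideanSpace ℝ (Fin d)}
    {Z : Set (EuclideanSpace ℝ (Fin d))} (h : G.IsGenerator i y Z) : Z ⊆ G.action i := by
  obtain ⟨α, z, hd, -, rfl⟩ := h
  rintro p ⟨k, -, rfl⟩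
  exact hd.2.1 k

lemma IsRegular.exists_isGenerator (hG : G.IsRegular) (i : Fin n)
    {y : Fin n → EuclideanSpace ℝ (Fin d)} (hy : y ∈ G.profiles) : ∃ Z, G.IsGenerator i y Z := by
  obtain ⟨α, z, h1, h2⟩ := hG.exists_minimal_decomposition i hy
  exact ⟨_, α, z, h1, h2, rfl⟩

lemma IsRegular.convexified_cost_update_le (hG : G.IsRegular) {i : Fin n}
    {y : Fin n → EuclideanSpace ℝ (Fin d)} (hy : y ∈ G.profiles) {z : EuclideanSpace ℝ (Fin d)}
    (hz : z ∈ G.action i) :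
    G.convexified.cost i (Function.update y i z) ≤ G.cost i (Function.update y i z) := by
  have hs : (Pi.single 0 1 : Fin (d + 1) → ℝ) ∈ stdSimplex ℝ (Fin (d + 1)) :=
    single_mem_stdSimplex ℝ 0
  have hd : G.IsDecomposition i (Function.update y i z) (Pi.single 0 1) fun _ => z :=
    isDecomposition_update_iff.2 ⟨hs, fun _ => hz, by rw [← Finset.sum_smul, hs.2, one_smul]⟩
  refine (hG.convexified_cost_le (update_mem_profiles hy (subset_convexHull ℝ _ hz)) hd).trans ?_
  rw [decompositionCost_update, decompositionCost, ← Finset.sum_mul, hs.2, one_mul]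

/-- Against an equilibrium of the convexified game, every point of a generator is a best reply. -/
lemma IsGenerator.cost_le (hG : G.IsRegular) {y : Fin n → EuclideanSpace ℝ (Fin d)}
    (hy : G.convexified.IsPNE y) {i : Fin n} {Z : Set (EuclideanSpace ℝ (Fin d))}
    (hZ : G.IsGenerator i y Z) {p z : EuclideanSpace ℝ (Fin d)} (hp : p ∈ Z)
    (hz : z ∈ G.action i) :
    G.cost i (Function.update y i p) ≤ G.cost i (Function.update y i z) := by
  have hyK : y ∈ G.profiles := mem_profiles.2 hy.1
  have hle : ∀ z ∈ G.action i, G.convexified.cost i y ≤ G.cost i (Function.update y i z) := by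
    intro z hz
    have h1 := hy.2 i z (subset_convexHull ℝ _ hz)
    rw [add_zero] at h1
    exact h1.trans (hG.convexified_cost_update_le hyK hz)
  obtain ⟨α, w, hd, hmin, rfl⟩ := hZ
  obtain ⟨k, hk, rfl⟩ := hp
  have hcost := convexified_cost_eq hd hmin
  -- A weighted average of nonnegative excesses vanishes, so every excess with positive weight is
  -- zero.
  have hsum : ∑ k, α k * (G.cost i (Function.update y i (w k)) - G.convexified.cost i y) = 0 := by
    simp only [mul_sub, Finset.sum_sub_distrib, ← Finset.sum_mul, hd.1.2]
    rw [hcost, decompositionCost]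
    ring
  have h0 := (Finset.sum_eq_zero_iff_of_nonneg fun k _ =>
    mul_nonneg (hd.1.1 k) (sub_nonneg.2 (hle _ (hd.2.1 k)))).1 hsum k (Finset.mem_univ k)
  have h1 := (mul_eq_zero.1 h0).resolve_left hk.ne'
  linarith [hle z hz]

end Game

/-! ### Semicontinuity from the Hölder condition. -/

/-- The Hölder bound is uniform in the first variable, so the second can be frozen at `s₀` with an
error below `c' - c`. -/
lemma LowerSemicontinuousOn.prod_of_holder {P F : Type*} [TopologicalSpace P]
    [NormedAddCommGroup F] {X : Set P} {Ω : Set F} {f : P → F → ℝ} {H γ : ℝ} (hγ : 0 < γ)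
    (hlsc : ∀ s ∈ Ω, LowerSemicontinuousOn (fun x => f x s) X)
    (hH : ∀ x ∈ X, ∀ s ∈ Ω, ∀ s' ∈ Ω, |f x s' - f x s| ≤ H * ‖s' - s‖ ^ γ) :
    LowerSemicontinuousOn (fun p : P × F => f p.1 p.2) (X ×ˢ Ω) := by
  rintro ⟨x₀, s₀⟩ ⟨hx₀, hs₀⟩ c hc
  obtain ⟨c', hcc', hc'⟩ := exists_between (show c < f x₀ s₀ from hc)
  have h1 : LowerSemicontinuousOn (fun p : P × F => f p.1 s₀) (X ×ˢ Ω) :=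
    LowerSemicontinuousOn.comp (g := fun p : P × F => p.1) (hlsc s₀ hs₀) continuousOn_fst
      fun p hp => hp.1
  have h2 : Continuous fun p : P × F => H * ‖p.2 - s₀‖ ^ γ :=
    continuous_const.mul ((continuous_snd.sub continuous_const).norm.rpow_const
      fun _ => Or.inr hγ.le)
  have h3 : ∀ᶠ p in 𝓝[X ×ˢ Ω] (x₀, s₀), H * ‖p.2 - s₀‖ ^ γ < c' - c :=
    h2.continuousWithinAt.eventually_lt_const (by
      simp only [sub_self, norm_zero, Real.zero_rpow hγ.ne', mul_zero]
      linarith)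
  filter_upwards [h1 (x₀, s₀) ⟨hx₀, hs₀⟩ c' hc', h3, self_mem_nhdsWithin] with p hp1 hp2 hp
  have hp1' : c' < f p.1 s₀ := hp1
  have h4 := (abs_le.1 (hH p.1 hp.1 s₀ hs₀ p.2 hp.2)).1
  change c < f p.1 p.2
  linarith

lemma continuousOn_of_holder {F : Type*} [NormedAddCommGroup F] {Ω : Set F} {f : F → ℝ} {H γ : ℝ}
    (hγ : 0 < γ) (hH : ∀ s ∈ Ω, ∀ s' ∈ Ω, |f s' - f s| ≤ H * ‖s' - s‖ ^ γ) :
    ContinuousOn f Ω := by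
  intro s hs
  have h1 : Continuous fun s' : F => H * ‖s' - s‖ ^ γ :=
    continuous_const.mul ((continuous_id.sub continuous_const).norm.rpow_const
      fun _ => Or.inr hγ.le)
  have h2 : Filter.Tendsto (fun s' : F => H * ‖s' - s‖ ^ γ) (𝓝[Ω] s) (𝓝 0) := by
    have := h1.continuousWithinAt (s := Ω) (x := s)
    simpa [ContinuousWithinAt, Real.zero_rpow hγ.ne'] using this
  rw [ContinuousWithinAt, tendsto_iff_dist_tendsto_zero]
  refine squeeze_zero' (Filter.Eventually.of_forall fun _ => dist_nonneg) ?_ h2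
  filter_upwards [self_mem_nhdsWithin] with s' hs'
  rw [Real.dist_eq]
  exact hH s hs s' hs'

/-! ### Aggregates and disaggregation. -/

section Aggregate

variable {n d q : ℕ} (A : Fin n → Matrix (Fin q) (Fin d) ℝ)

lemma continuous_aggregate : Continuous (aggregate A) :=
  continuous_finsetSum _ fun j _ =>
    (LinearMap.continuous_of_finiteDimensional _).comp (continuous_apply j)

lemma aggregate_update (x : Fin n → EuclideanSpace ℝ (Fin d)) (i : Fin n)
    (w : EuclideanSpace ℝ (Fin d)) :
    aggregate A (Function.update x i w) =
      aggregate A x + Matrix.toEuclideanLin (A i) (w - x i) := by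
  rw [← sub_eq_iff_eq_add', aggregate, aggregate, ← Finset.sum_sub_distrib,
    Finset.sum_eq_single i]
  · simp
  · intro j _ hj
    simp [hj]
  · simp

lemma norm_toEuclideanLin_sub_le {B : Matrix (Fin q) (Fin d) ℝ} {M Δ : ℝ} (hM : 0 ≤ M)
    (hB : ‖B‖ ≤ M) {S : Set (EuclideanSpace ℝ (Fin d))} (hS : Bornology.IsBounded S)
    (hdiam : Metric.diam S ≤ Δ) {u v : EuclideanSpace ℝ (Fin d)} (hu : u ∈ S) (hv : v ∈ S) :
    ‖Matrix.toEuclideanLin B (u - v)‖ ≤ M * Δ := by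
  have h1 : ‖u - v‖ ≤ Δ := by
    rw [← dist_eq_norm]
    exact (Metric.dist_le_diam_of_mem hS hu hv).trans hdiam
  have h2 : ‖Matrix.toEuclideanLin B (u - v)‖ ≤ ‖B‖ * ‖u - v‖ :=
    Matrix.l2_opNorm_mulVec B (u - v)
  exact h2.trans (mul_le_mul hB h1 (norm_nonneg _) hM)

end Aggregate

namespace IsDisaggregation

variable {n d q : ℕ} {A : Fin n → Matrix (Fin q) (Fin d) ℝ}
  {y x : Fin n → EuclideanSpace ℝ (Fin d)} {Z : Fin n → Set (EuclideanSpace ℝ (Fin d))}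

lemma exists_of_finite (hZ : ∀ i, (Z i).Finite) (hne : ∀ i, (Z i).Nonempty) :
    ∃ x, IsDisaggregation A y Z x := by
  choose a ha using hne
  obtain ⟨x, hx, hmin⟩ := Set.exists_min_image (Set.univ.pi Z)
    (fun w => ‖aggregate A y - aggregate A w‖ ^ 2) (Set.Finite.pi' hZ |>.subset fun w hw i =>
      hw i trivial) ⟨a, fun i _ => ha i⟩
  exact ⟨x, fun i => hx i trivial, fun w hw => hmin w fun i _ => hw i⟩

/-- The Starr selection uses only points of positive weight, so it competes in the minimisation
defining `x`. -/
lemma norm_aggregate_sub_le {G : Game n d} {M Δ : ℝ} (hM : 0 ≤ M) (hΔ : 0 ≤ Δ)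
    (hA : ∀ i, ‖A i‖ ≤ M) (hc : ∀ i, IsCompact (G.action i))
    (hdiam : ∀ i, Metric.diam (G.action i) ≤ Δ) (hZ : ∀ i, G.IsGenerator i y (Z i))
    (hx : IsDisaggregation A y Z x) :
    ‖aggregate A y - aggregate A x‖ ≤ √q * (M * Δ) := by
  choose α z hd _ hZ' using hZ
  obtain ⟨κ, hκ, hle⟩ := exists_selection_norm_le (a := α) (fun j => (hd j).1)
    (p := fun j k => Matrix.toEuclideanLin (A j) (z j k)) (mul_nonneg hM hΔ) (fun j k l => by
      rw [← map_sub]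
      exact norm_toEuclideanLin_sub_le hM (hA j) (hc j).isBounded (hdiam j)
        ((hd j).2.1 k) ((hd j).2.1 l))
  have hy : aggregate A y = ∑ j, ∑ k, α j k • Matrix.toEuclideanLin (A j) (z j k) :=
    Finset.sum_congr rfl fun j _ => by
      rw [(hd j).2.2, map_sum]
      simp only [map_smul]
  rw [finrank_euclideanSpace_fin, ← hy] at hle
  have h1 := hx.2 (fun j => z j (κ j)) fun j => by
    rw [hZ' j]
    exact ⟨κ j, hκ j, rfl⟩
  exact ((sq_le_sq₀ (norm_nonneg _) (norm_nonneg _)).1 h1).trans hle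

end IsDisaggregation

/-! ### The sum-aggregative game. -/

section SumAggregative

variable {n d q : ℕ} {X : Fin n → Set (EuclideanSpace ℝ (Fin d))}
  {A : Fin n → Matrix (Fin q) (Fin d) ℝ} {Ω : Set (EuclideanSpace ℝ (Fin q))}
  {θ : Fin n → EuclideanSpace ℝ (Fin d) → EuclideanSpace ℝ (Fin q) → ℝ} {H γ : ℝ}

lemma sumAggregativeGame_cost_update (x : Fin n → EuclideanSpace ℝ (Fin d)) (i : Fin n)
    (z : EuclideanSpace ℝ (Fin d)) :
    (sumAggregativeGame X A θ).cost i (Function.update x i z) =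
      θ i z ((1 / (n : ℝ)) • aggregate A (Function.update x i z)) := by
  simp [sumAggregativeGame]

lemma sumAggregativeGame_isRegular (hXne : ∀ i, (X i).Nonempty) (hXc : ∀ i, IsCompact (X i))
    (hΩ : ∀ x ∈ (sumAggregativeGame X A θ).profiles, (1 / (n : ℝ)) • aggregate A x ∈ Ω)
    (hγ : 0 < γ)
    (hlsc : ∀ i, ∀ y ∈ Ω, LowerSemicontinuousOn (fun x => θ i x y) (X i))
    (hHolder : ∀ i, ∀ x ∈ X i, ∀ y ∈ Ω, ∀ y' ∈ Ω, |θ i x y' - θ i x y| ≤ H * ‖y' - y‖ ^ γ) :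
    (sumAggregativeGame X A θ).IsRegular where
  nonempty := hXne
  compact := hXc
  lsc i := by
    simp only [sumAggregativeGame_cost_update]
    have hcont : Continuous fun p : (Fin n → EuclideanSpace ℝ (Fin d)) ×
        EuclideanSpace ℝ (Fin d) => (1 / (n : ℝ)) • aggregate A (Function.update p.1 i p.2) :=
      (continuous_const_smul _).comp ((continuous_aggregate A).comp
        (continuous_fst.update i continuous_snd))
    exact LowerSemicontinuousOn.comp (g := fun p : (Fin n → EuclideanSpace ℝ (Fin d)) ×
      EuclideanSpace ℝ (Fin d) =>
        (p.2, (1 / (n : ℝ)) • aggregate A (Function.update p.1 i p.2)))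
      (LowerSemicontinuousOn.prod_of_holder hγ (hlsc i) (hHolder i))
      (continuous_snd.prodMk hcont).continuousOn
      fun p hp => ⟨hp.2, hΩ _ (Game.update_mem_profiles hp.1 (subset_convexHull ℝ _ hp.2))⟩
  cont i z hz := by
    simp only [sumAggregativeGame_cost_update]
    have hcont : Continuous fun x : Fin n → EuclideanSpace ℝ (Fin d) =>
        (1 / (n : ℝ)) • aggregate A (Function.update x i z) :=
      (continuous_const_smul _).comp ((continuous_aggregate A).comp
        (continuous_id.update i continuous_const))
    exact (continuousOn_of_holder hγ (hHolder i z hz)).comp hcont.continuousOn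
      fun x hx => hΩ _ (Game.update_mem_profiles hx (subset_convexHull ℝ _ hz))

/-- Replacing the actions of the others changes the cost by at most `H (R / n) ^ γ`. -/
lemma abs_sumAggregativeGame_cost_sub_le (hn : 1 ≤ n)
    (hΩ : ∀ x ∈ (sumAggregativeGame X A θ).profiles, (1 / (n : ℝ)) • aggregate A x ∈ Ω)
    (hH : 0 ≤ H) (hγ : 0 < γ)
    (hHolder : ∀ i, ∀ x ∈ X i, ∀ y ∈ Ω, ∀ y' ∈ Ω, |θ i x y' - θ i x y| ≤ H * ‖y' - y‖ ^ γ)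
    {M Δ : ℝ} (hM : 0 ≤ M) (hA : ∀ i, ‖A i‖ ≤ M) (hXc : ∀ i, IsCompact (X i))
    (hdiam : ∀ i, Metric.diam (X i) ≤ Δ) {x y : Fin n → EuclideanSpace ℝ (Fin d)}
    (hx : x ∈ (sumAggregativeGame X A θ).profiles)
    (hy : y ∈ (sumAggregativeGame X A θ).profiles)
    (hxy : ‖aggregate A y - aggregate A x‖ ≤ √q * (M * Δ)) (i : Fin n)
    {w : EuclideanSpace ℝ (Fin d)} (hw : w ∈ X i) :
    |(sumAggregativeGame X A θ).cost i (Function.update x i w) -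
      (sumAggregativeGame X A θ).cost i (Function.update y i w)| ≤
        H * ((√q + 1) * M * Δ / n) ^ γ := by
  have hn0 : (0 : ℝ) < n := by exact_mod_cast hn
  rw [sumAggregativeGame_cost_update, sumAggregativeGame_cost_update]
  have hwc := subset_convexHull ℝ (X i) hw
  refine (hHolder i w hw _ (hΩ _ (Game.update_mem_profiles hy hwc)) _
    (hΩ _ (Game.update_mem_profiles hx hwc))).trans ?_
  refine mul_le_mul_of_nonneg_left (Real.rpow_le_rpow (norm_nonneg _) ?_ hγ.le) hH
  -- With the common action `w`, the aggregates differ by the original gap and player `i`'s own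
  -- shift. The latter is the `+ 1` beside `√q`; it is bounded using that a convex hull has the same
  -- diameter as the set.
  have heq : aggregate A (Function.update x i w) - aggregate A (Function.update y i w) =
      Matrix.toEuclideanLin (A i) (y i - x i) - (aggregate A y - aggregate A x) := by
    rw [aggregate_update, aggregate_update, map_sub, map_sub, map_sub]
    abel
  have hi : ‖Matrix.toEuclideanLin (A i) (y i - x i)‖ ≤ M * Δ :=
    norm_toEuclideanLin_sub_le hM (hA i) (isBounded_convexHull.2 (hXc i).isBounded)
      ((convexHull_diam _).trans_le (hdiam i)) (Game.mem_profiles.1 hy i)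
      (Game.mem_profiles.1 hx i)
  rw [← smul_sub, norm_smul, heq, Real.norm_of_nonneg (by positivity), one_div,
    inv_mul_eq_div]
  gcongr
  refine (norm_sub_le _ _).trans ((add_le_add hi hxy).trans (le_of_eq ?_))
  ring

end SumAggregative

theorem mainTheorem2 {n d q : ℕ} (hn : 1 ≤ n)
    (X : Fin n → Set (EuclideanSpace ℝ (Fin d)))
    (hXne : ∀ i, (X i).Nonempty) (hXc : ∀ i, IsCompact (X i))
    (A : Fin n → Matrix (Fin q) (Fin d) ℝ)
    (Ω : Set (EuclideanSpace ℝ (Fin q)))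
    (hΩ : Ω ∈ 𝓝ˢ {s : EuclideanSpace ℝ (Fin q) |
      ∃ y : Fin n → EuclideanSpace ℝ (Fin d),
        (∀ j, y j ∈ convexHull ℝ (X j)) ∧ s = (1 / (n : ℝ)) • aggregate A y})
    (θ : Fin n → EuclideanSpace ℝ (Fin d) → EuclideanSpace ℝ (Fin q) → ℝ)
    (Δ M H γ : ℝ) (hΔ : 0 < Δ) (hM : 0 < M) (hH : 0 < H) (hγ : 0 < γ)
    (hdiam : ∀ i, Metric.diam (X i) ≤ Δ)
    (hA : ∀ i, ‖A i‖ ≤ M)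
    (hlsc : ∀ i, ∀ y ∈ Ω, LowerSemicontinuousOn (fun x => θ i x y) (X i))
    (hHolder : ∀ i, ∀ x ∈ X i, ∀ y ∈ Ω, ∀ y' ∈ Ω,
      |θ i x y' - θ i x y| ≤ H * ‖y' - y‖ ^ γ)
    (ε : ℝ) (hε : ε = 2 * H * ((Real.sqrt q + 1) * M * Δ / n) ^ γ) :
    (∃ x, (sumAggregativeGame X A θ).IsEpsPNE ε x) ∧
    (∃ y, (sumAggregativeGame X A θ).convexified.IsPNE y) ∧
    ∀ y, (sumAggregativeGame X A θ).convexified.IsPNE y →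
      (∀ i, ∃ Z, (sumAggregativeGame X A θ).IsGenerator i y Z) ∧
      ∀ Z : Fin n → Set (EuclideanSpace ℝ (Fin d)),
        (∀ i, (sumAggregativeGame X A θ).IsGenerator i y (Z i)) →
        (∃ x, IsDisaggregation A y Z x) ∧
        ∀ x, IsDisaggregation A y Z x → (sumAggregativeGame X A θ).IsEpsPNE ε x := by

  have hΩ' : ∀ x ∈ (sumAggregativeGame X A θ).profiles, (1 / (n : ℝ)) • aggregate A x ∈ Ω :=
    fun x hx => subset_of_mem_nhdsSet hΩ ⟨x, Game.mem_profiles.1 hx, rfl⟩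
  have hG : (sumAggregativeGame X A θ).IsRegular :=
    sumAggregativeGame_isRegular hXne hXc hΩ' hγ hlsc hHolder
  have hgen : ∀ y, (sumAggregativeGame X A θ).convexified.IsPNE y →
      ∀ i, ∃ Z, (sumAggregativeGame X A θ).IsGenerator i y Z := fun y hy i =>
    hG.exists_isGenerator i (Game.mem_profiles.2 hy.1)
  have hdis : ∀ y, (sumAggregativeGame X A θ).convexified.IsPNE y →
      ∀ Z : Fin n → Set (EuclideanSpace ℝ (Fin d)),
        (∀ i, (sumAggregativeGame X A θ).IsGenerator i y (Z i)) →
        (∃ x, IsDisaggregation A y Z x) ∧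
        ∀ x, IsDisaggregation A y Z x → (sumAggregativeGame X A θ).IsEpsPNE ε x := by
    refine fun y hy Z hZ => ⟨IsDisaggregation.exists_of_finite (fun i => (hZ i).finite)
      fun i => (hZ i).nonempty, fun x hx => ?_⟩
    have hxX : ∀ i, x i ∈ X i := fun i => (hZ i).subset_action (hx.1 i)
    refine ⟨hxX, fun i z hz => ?_⟩
    have hclose := fun {w} => abs_sumAggregativeGame_cost_sub_le hn hΩ' hH.le hγ hHolder hM.le
      hA hXc hdiam (Game.mem_profiles.2 fun j => subset_convexHull ℝ _ (hxX j))
      (Game.mem_profiles.2 hy.1)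
      (hx.norm_aggregate_sub_le hM.le hΔ.le hA hXc hdiam hZ) i (w := w)
    -- The factor 2 in `ε`: one half pays for passing from `x` to `y` at the action `x i`, the other
    -- for returning at `z`. In between, `x i` is a best reply to `y`.
    have h1 := hclose (hxX i)
    have h2 := hclose hz
    have h3 := (hZ i).cost_le hG hy (hx.1 i) hz
    rw [Function.update_eq_self] at h1
    rw [abs_le] at h1 h2
    rw [hε]
    linarith [h1.2, h2.1]
  obtain ⟨y, hy⟩ := hG.exists_isPNE_convexified
  choose Z hZ using hgen y hy
  obtain ⟨⟨x, hx⟩, h⟩ := hdis y hy Z hZ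
  exact ⟨⟨x, h x hx⟩, ⟨y, hy⟩, fun y hy => ⟨hgen y hy, hdis y hy⟩⟩
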